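/- **Circuit.** Let $G$ be a finite connected oriented multigraph without loops, each edge of which carries one circuit element: a voltage source (independent or controlled, edge set $\mathcal V=\mathcal V^{i}\sqcup\mathcal V^{c}$), a capacitor ($\mathcal C$), a dissipator ($\mathcal D$), an inductor ($\mathcal L$) or a current source (independent or controlled, $\mathcal I=\mathcal I^{i}\sqcup\mathcal I^{c}$). Let $A$ be the oriented incidence matrix. Assume that no cycle consists of voltage sources only and no cutset consists of current sources only. Let $T$ be a normal tree, i.e. a spanning tree containing all voltage sources, $\operatorname{rank}[A_{\mathcal V}A_{\mathcal C}]-\operatorname{rank}A_{\mathcal V}$ capacitors, $\operatorname{rank}[A_{\mathcal V}A_{\mathcal C}A_{\mathcal D}]-\operatorname{rank}[A_{\mathcal V}A_{\mathcal C}]$ dissipators, $\operatorname{rank}[A_{\mathcal V}A_{\mathcal C}A_{\mathcal D}A_{\mathcal L}]-\operatorname{rank}[A_{\mathcal V}A_{\mathcal C}A_{\mathcal D}]$ inductors and no current source; let $N$ be its cotree. Lowercase letters $v^{c},c,d,l$ denote the controlled voltage sources, capacitors, dissipators and inductors in $T$; capitals $C,D,L,I^{c}$ denote the capacitors, dissipators,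 inductors and controlled current sources in $N$; and $n_{\bullet}$ denotes the number of elements. Let $F$ be the cycle-cutset matrix of $T$ (rows $N$, columns $T$), defined by $a_i=-\sum_{j\in T}F_{ij}a_j$ for $i\in N$, where $a_k$ are the columns of $A$. Kirchhoff's laws read $i_T=F^{\mathsf T}i_N$, $v_N=-Fv_T$. **Constitutive relations.** Let $\mathbb T\subseteq\mathbb R$ be a nondegenerate interval. - Capacitors have charges $q$, $i_{\mathcal C}=\dot q$, $v_{\mathcal C}=\nabla H_{\mathcal C}(q)$; inductors have flux linkages $\phi$, $v_{\mathcal L}=\dot\phi$, $i_{\mathcal L}=\nabla H_{\mathcal L}(\phi)$, where $H_{\mathcal C},H_{\mathcal L}$ are $C^2$ on $\mathbb R^{n_{\mathcal C}}$ and $\mathbb R^{n_{\mathcal L}}$ with everywhere positive definite Hessians. - The dissipators satisfy $r(i_{\mathcal D},v_{\mathcal D})=0$ with $r:\mathbb R^{n_{\mathcal D}}\times\mathbb R^{n_{\mathcal D}}\to\mathbb R^{n_{\mathcal D}}$ of class $C^1$ such that $(B,B')=(\partial r/\partial i_{\mathcal D},\partial r/\partial v_{\mathcal D})$ is a positive definite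 matrix pair at every solution of $r=0$, i.e. $y^{\mathsf T}y'>0$ whenever $(y,y')\neq(0,0)$ and $By+B'y'=0$. For a partition $\mathcal D=\mathcal R\sqcup\mathcal G$, this relation is represented in the mixed form $(v_{\mathcal R},i_{\mathcal G})=\rho(w)$, $w=(i_{\mathcal R},v_{\mathcal G})$, with $\rho$ of class $C^1$ on an open set $\Omega\subseteq\mathbb R^{n_{\mathcal D}}$. - The independent sources are given by $C^1$ functions on $\mathbb T$: $v_{\mathcal V^{i}}=V(t)$, $i_{\mathcal I^{i}}=I(t)$. - The voltages of the controlled voltage sources are a $C^1$ function of $t$, of voltages of capacitors and independent voltage sources and of currents of inductors and independent current sources; hence $v_{v^{c}}=\gamma_v(q,\phi,t)$. The currents of the controlled current sources are a $C^1$ function of these quantities and of the voltages and currents of dissipators; hence $i_{I^{c}}=\gamma_I(q,\phi,w,t)$. - No controlled voltage source lies on a cycle formed by capacitors and voltage sources, and no controlled current source lies in a cutset formed by inductors and current sources. Moreover $F_{I^{c}d}=0$. **Model 3 system.** The unknown is $x=(q,\phi,w,v_{v^{c}},i_{I^{c}},i_{v^{c}},v_{I^{c}})$. The system $f(t,x,\dot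 x)=0$, considered for $t\in\mathbb T$ and $w\in\Omega$, consists of the equations $i_T-F^{\mathsf T}i_N=0$ for the twigs and $v_N+Fv_T=0$ for the links that are not independent sources, with the constitutive relations inserted, and of $v_{v^{c}}-\gamma_v(q,\phi,t)=0$ and $i_{I^{c}}-\gamma_I(q,\phi,w,t)=0$. **Theorem 4.10.** If $n_C=n_l=n_d=n_D=n_{v^{c}}=n_{I^{c}}=0$, the Model 3 system is an ODE, i.e. equivalent to $\dot x=\varphi(t,x)$ with $\varphi$ continuous. Otherwise it is a DAE of (differentiation) index 1 at every point $(t,x)$, with $t\in\mathbb T$ and $w\in\Omega$, for which $f(t,x,\dot x)=0$ has a solution $\dot x$. Here the system has index $\nu$ at $(t_0,x_0)$ if the equations and their total time derivatives up to order $\nu$ have a common solution $(\dot x,\dots,x^{(\nu+1)})$ at $(t_0,x_0)$, and if $\nu$ is the least number for which, near $(t_0,x_0)$, one can differentiate each equation a suitable number of times, at most $\nu$, so that the original and differentiated equations together determine $\dot x$ as a continuous function of $(t,x)$. -/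

import Mathlib

/-! ### Differential-algebraic equations and the differentiation index -/

namespace Dae

/-- A square first-order system `f(t, x, ẋ) = 0` with unknowns and equations indexed by `ι`. -/
abbrev System (ι : Type*) := ℝ → (ι → ℝ) → (ι → ℝ) → (ι → ℝ)

/-- The Taylor polynomial at `t` with prescribed derivatives `X 0, X 1, …, X n` at `t`. -/
noncomputable def jetCurve {ι : Type*} {n : ℕ} (t : ℝ) (X : Fin (n + 1) → ι → ℝ) (s : ℝ) : ι → ℝ :=
  ∑ k : Fin (n + 1), ((s - t) ^ (k : ℕ) / ((k : ℕ).factorial : ℝ)) • X k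

/-- The enlarged set of equations: the values `X = (x, ẋ, …, x^(m+1))` at time `t` satisfy
`f_i = 0, (d/dt) f_i = 0, …, (d/dt)^(c i) f_i = 0` for every `i` (where `c i ≤ m`).
The total derivative `(d/dt)^k f_i` at `(t, X)` is the `k`-th derivative of
`s ↦ f_i(s, y(s), ẏ(s))` at `t` for a curve `y` with derivatives `X` at `t`
(derivatives are relative to the time interval `𝕋`, hence one-sided at an endpoint). -/
def DerivativeArray {ι : Type*} (𝕋 : Set ℝ) (f : System ι) (c : ι → ℕ) {m : ℕ}
    (t : ℝ) (X : Fin (m + 2) → ι → ℝ) : Prop :=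
  ∀ i, ∀ k ≤ c i,
    iteratedDerivWithin k (fun s => f s (jetCurve t X s) (deriv (jetCurve t X) s) i) 𝕋 t = 0

/-- On `U`, the enlarged set of equations (in the unknowns `x, ẋ, …, x^(m+1)`) can be solved for
`ẋ` as a continuous function of `(t, x)`. -/
def SolvesToODE {ι : Type*} (𝕋 : Set ℝ) (f : System ι) (c : ι → ℕ) (m : ℕ)
    (U : Set (ℝ × (ι → ℝ))) : Prop :=
  ∃ φ : ℝ × (ι → ℝ) → (ι → ℝ), ContinuousOn φ U ∧
    ∀ (t : ℝ) (X : Fin (m + 2) → ι → ℝ),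
      (t, X 0) ∈ U → DerivativeArray 𝕋 f c t X → X 1 = φ (t, X 0)

/-- The system `f(t, x, ẋ) = 0`, considered for `(t, x) ∈ S` with `t` in the interval `𝕋`, has
differentiation index `ν` at `(t₀, x₀)`. First, the point is consistent: the equations together
with their time derivatives up to order `ν` have a solution there. Second, `ν` is the least number
such that, near the point, one can get an ODE in `x` by adjoining time derivatives of the
equations, no equation being differentiated more than `ν` times. -/
def HasIndexAt {ι : Type*} [Fintype ι] (𝕋 : Set ℝ) (S : Set (ℝ × (ι → ℝ))) (f : System ι)
    (t₀ : ℝ) (x₀ : ι → ℝ) (ν : ℕ) : Prop :=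
  (t₀, x₀) ∈ S ∧
  (∃ X : Fin (ν + 2) → ι → ℝ, X 0 = x₀ ∧ DerivativeArray 𝕋 f (fun _ => ν) t₀ X) ∧
  IsLeast {μ : ℕ | ∃ c : ι → ℕ, (∀ i, c i ≤ μ) ∧
    ∃ U ∈ nhds (t₀, x₀), SolvesToODE 𝕋 f c μ (S ∩ U)} ν

/-- The system `f(t, x, ẋ) = 0` is an ODE on `S`: it is equivalent to `ẋ = φ(t, x)` with `φ`
continuous. -/
def IsODE {ι : Type*} [Fintype ι] (S : Set (ℝ × (ι → ℝ))) (f : System ι) : Prop :=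
  ∃ φ : ℝ × (ι → ℝ) → (ι → ℝ), ContinuousOn φ S ∧
    ∀ t x, (t, x) ∈ S → ∀ xp, f t x xp = 0 ↔ xp = φ (t, x)

end Dae

/-! ### Calculus and positive definiteness -/

namespace Circuit

/-- Gradient (vector of partial derivatives). -/
noncomputable def grad {κ : Type*} [Fintype κ] [DecidableEq κ] (H : (κ → ℝ) → ℝ)
    (z : κ → ℝ) : κ → ℝ :=
  fun k => fderiv ℝ H z (Pi.single k 1)

/-- Hessian (matrix of second partial derivatives). -/
noncomputable def hessian {κ : Type*} [Fintype κ] [DecidableEq κ] (H : (κ → ℝ) → ℝ)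
    (z : κ → ℝ) : Matrix κ κ ℝ :=
  Matrix.of fun k l => fderiv ℝ (fun w => grad H w k) z (Pi.single l 1)

/-- Jacobian matrix. -/
noncomputable def jacobian {κ : Type*} [Fintype κ] [DecidableEq κ] (g : (κ → ℝ) → (κ → ℝ))
    (z : κ → ℝ) : Matrix κ κ ℝ :=
  Matrix.of fun k l => fderiv ℝ g z (Pi.single l 1) k

/-- Positive definite real matrix, not necessarily symmetric. -/
def IsPD {κ : Type*} [Fintype κ] (M : Matrix κ κ ℝ) : Prop :=
  ∀ y : κ → ℝ, y ≠ 0 → 0 < y ⬝ᵥ M.mulVec y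

/-- Positive definite matrix pair. -/
def IsPDPair {κ : Type*} [Fintype κ] (B B' : Matrix κ κ ℝ) : Prop :=
  ∀ y y' : κ → ℝ, ¬(y = 0 ∧ y' = 0) → B.mulVec y + B'.mulVec y' = 0 → 0 < y ⬝ᵥ y'

/-! ### Circuit graphs -/

/-- The kinds of circuit elements. The dissipators are split into `resistor`s and `conductor`s:
for the former the current, for the latter the voltage, is chosen as describing variable. -/
inductive Kind
  | indepVoltage | ctrlVoltage | capacitor | resistor | conductor | inductor
  | indepCurrent | ctrlCurrent
  deriving DecidableEq

namespace Kind

/-- All voltage sources. -/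
abbrev voltage : Finset Kind := {indepVoltage, ctrlVoltage}
/-- All dissipators. -/
abbrev dissipator : Finset Kind := {resistor, conductor}
/-- All current sources. -/
abbrev current : Finset Kind := {indepCurrent, ctrlCurrent}
/-- All controlled sources. -/
abbrev controlled : Finset Kind := {ctrlVoltage, ctrlCurrent}
/-- Everything except the independent sources. -/
abbrev internal : Finset Kind :=
  {capacitor, inductor, resistor, conductor, ctrlVoltage, ctrlCurrent}

theorem controlled_subset : controlled ⊆ internal := by decide

theorem ctrlCurrent_of {k : Kind} (hk : k ∈ controlled)
    (h : k ∉ ({ctrlVoltage} : Finset Kind)) : k ∈ ({ctrlCurrent} : Finset Kind) := by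
  simp_all

end Kind

/-- An oriented circuit graph with vertices `𝒱` and edges `ε` (parallel edges allowed, no loops),
with a circuit element on each edge. -/
structure Network (𝒱 ε : Type*) where
  tail : ε → 𝒱
  head : ε → 𝒱
  tail_ne_head : ∀ e, tail e ≠ head e
  kind : ε → Kind

namespace Network

variable {𝒱 ε : Type*} [Fintype 𝒱] [DecidableEq 𝒱] [Fintype ε] [DecidableEq ε]

/-- The edges whose kind lies in `K`, as a finite set. -/
def edges (G : Network 𝒱 ε) (K : Finset Kind) : Finset ε := {e | G.kind e ∈ K}

/-- The edges whose kind lies in `K`, as a type. -/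
abbrev Branch (G : Network 𝒱 ε) (K : Finset Kind) := {e : ε // G.kind e ∈ K}

/-- Edge `e` joins the vertices `u` and `v`. -/
def Joins (G : Network 𝒱 ε) (e : ε) (u v : 𝒱) : Prop :=
  (G.tail e = u ∧ G.head e = v) ∨ (G.tail e = v ∧ G.head e = u)

/-- `C` is the edge set of a cycle: a closed trail `v 0, e 0, v 1, e 1, …, v n, e n, v 0` with
distinct edges and distinct vertices (addition in `Fin (n + 1)` is cyclic). -/
def IsCycle (G : Network 𝒱 ε) (C : Finset ε) : Prop :=
  ∃ (n : ℕ) (v : Fin (n + 1) → 𝒱) (e : Fin (n + 1) → ε),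
    Function.Injective v ∧ Function.Injective e ∧
    (∀ i, G.Joins (e i) (v i) (v (i + 1))) ∧ C = Finset.univ.image e

/-- `C` is a cutset: the set of edges with ends in both sides of a cut. -/
def IsCutset (G : Network 𝒱 ε) (C : Finset ε) : Prop :=
  ∃ W : Finset 𝒱, W.Nonempty ∧ Wᶜ.Nonempty ∧
    ∀ e, e ∈ C ↔ ¬(G.tail e ∈ W ↔ G.head e ∈ W)

/-- The subgraph with all the vertices and with edge set `S` is connected. -/
def IsSpanning (G : Network 𝒱 ε) (S : Finset ε) : Prop :=
  Nonempty 𝒱 ∧ ∀ u v, Relation.ReflTransGen (fun a b => ∃ e ∈ S, G.Joins e a b) u v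

/-- Spanning tree (identified with its edge set). -/
def IsTree (G : Network 𝒱 ε) (T : Finset ε) : Prop :=
  G.IsSpanning T ∧ ∀ C, G.IsCycle C → ¬ C ⊆ T

/-- The oriented incidence matrix. -/
def incidence (G : Network 𝒱 ε) : Matrix 𝒱 ε ℝ :=
  Matrix.of fun u e => if u = G.tail e then 1 else if u = G.head e then -1 else 0

/-- Rank of the submatrix of the incidence matrix formed by the columns of kind in `K`. -/
noncomputable def rk (G : Network 𝒱 ε) (K : Finset Kind) : ℕ :=
  (G.incidence.submatrix id (Subtype.val : G.Branch K → ε)).rank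

/-- Number of twigs (tree edges) of kind in `K`. -/
def nTwig (G : Network 𝒱 ε) (T : Finset ε) (K : Finset Kind) : ℕ := (G.edges K ∩ T).card

/-- Number of links (cotree edges) of kind in `K`. -/
def nLink (G : Network 𝒱 ε) (T : Finset ε) (K : Finset Kind) : ℕ := (G.edges K \ T).card

open Kind in
/-- Normal tree: it contains all the voltage sources, `r_VC - r_V` capacitors, `r_VCD - r_VC`
dissipators, `r_VCDL - r_VCD` inductors and no current source. -/
structure IsNormalTree (G : Network 𝒱 ε) (T : Finset ε) : Prop where
  isTree : G.IsTree T
  voltage_subset : G.edges voltage ⊆ T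
  capacitors : G.nTwig T {capacitor} + G.rk voltage = G.rk (voltage ∪ {capacitor})
  dissipators : G.nTwig T dissipator + G.rk (voltage ∪ {capacitor}) =
    G.rk (voltage ∪ {capacitor} ∪ dissipator)
  inductors : G.nTwig T {inductor} + G.rk (voltage ∪ {capacitor} ∪ dissipator) =
    G.rk (voltage ∪ {capacitor} ∪ dissipator ∪ {inductor})
  no_current : Disjoint (G.edges Kind.current) T

/-- `F` expresses the link columns of the incidence matrix through the twig columns:
`a_i = - ∑_j F i j • a_j`, summed over the twigs `j`, for every link `i`. -/
def ExpressesLinks (G : Network 𝒱 ε) (T : Finset ε)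
    (F : Matrix {e : ε // e ∉ T} {e : ε // e ∈ T} ℝ) : Prop :=
  ∀ (i : {e : ε // e ∉ T}) (u : 𝒱),
    G.incidence u i = -∑ j : {e : ε // e ∈ T}, F i j * G.incidence u j

open Classical in
/-- The cycle-cutset matrix of a tree `T` (rows: links, columns: twigs), i.e. the unique matrix
of coefficients with `ExpressesLinks`; the value `0` is never used when `T` is a tree. -/
noncomputable def ccMatrix (G : Network 𝒱 ε) (T : Finset ε) :
    Matrix {e : ε // e ∉ T} {e : ε // e ∈ T} ℝ :=
  if h : ∃ F, G.ExpressesLinks T F then h.choose else 0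

/-! ### Constitutive relations -/

open Kind in
/-- Constitutive data of a circuit. -/
structure Data (G : Network 𝒱 ε) where
  /-- time interval -/
  𝕋 : Set ℝ
  /-- voltages of the independent voltage sources -/
  V : ℝ → G.Branch {indepVoltage} → ℝ
  /-- currents of the independent current sources -/
  I : ℝ → G.Branch {indepCurrent} → ℝ
  /-- energy of the capacitors as a function of the charges -/
  HC : (G.Branch {capacitor} → ℝ) → ℝ
  /-- energy of the inductors as a function of the flux linkages -/
  HL : (G.Branch {inductor} → ℝ) → ℝ
  /-- dissipators: implicit relation `r(i, v) = 0` -/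
  r : (G.Branch dissipator → ℝ) → (G.Branch dissipator → ℝ) → (G.Branch dissipator → ℝ)
  /-- domain of the (in general only local) mixed representation of the dissipators -/
  Ω : Set (G.Branch dissipator → ℝ)
  /-- mixed representation of the dissipators: `ρ` maps the resistor currents and conductor
  voltages to the resistor voltages and conductor currents -/
  ρ : (G.Branch dissipator → ℝ) → (G.Branch dissipator → ℝ)
  /-- Controlled voltage sources: their voltages as a function of time, of the controlling
  voltages (of capacitors and of independent voltage sources) and of the controlling currents
  (of inductors and of independent current sources). -/
  lawV : ℝ × (G.Branch {capacitor} → ℝ) × (G.Branch {indepVoltage} → ℝ) ×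
      (G.Branch {inductor} → ℝ) × (G.Branch {indepCurrent} → ℝ) →
    (G.Branch {ctrlVoltage} → ℝ)
  /-- Controlled current sources: their currents as a function of time, of the controlling
  voltages (of capacitors, of independent voltage sources and of dissipators) and of the
  controlling currents (of inductors, of independent current sources and of dissipators). -/
  lawI : ℝ × (G.Branch {capacitor} → ℝ) × (G.Branch {indepVoltage} → ℝ) ×
      (G.Branch dissipator → ℝ) × (G.Branch {inductor} → ℝ) × (G.Branch {indepCurrent} → ℝ) ×
      (G.Branch dissipator → ℝ) →
    (G.Branch {ctrlCurrent} → ℝ)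

/-- Index type of the DAE variables, and also of the equations. The variable `x (inl e)` is the
charge for a capacitor `e`, the flux linkage for an inductor, the current for a resistor, the
voltage for a conductor and the voltage for a controlled source. The variable `x (inr e)` is the
current of the controlled source `e`. -/
abbrev Var (G : Network 𝒱 ε) := G.Branch Kind.internal ⊕ G.Branch Kind.controlled

end Network

namespace Network.Data

open Kind

variable {𝒱 ε : Type*} [Fintype 𝒱] [DecidableEq 𝒱] [Fintype ε] [DecidableEq ε] {G : Network 𝒱 ε}

/-- Restriction of the variables `x (inl e)` to the edges of kind in `K ⊆ internal`. -/
def part (K : Finset Kind) (hK : K ⊆ internal) (x : G.Var → ℝ) : G.Branch K → ℝ :=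
  fun e => x (Sum.inl ⟨e.1, hK e.2⟩)

/-- Charges of the capacitors. -/
def charge (x : G.Var → ℝ) : G.Branch {capacitor} → ℝ := part {capacitor} (by decide) x

/-- Flux linkages of the inductors. -/
def flux (x : G.Var → ℝ) : G.Branch {inductor} → ℝ := part {inductor} (by decide) x

/-- Currents of the resistors and voltages of the conductors. -/
def dissVar (x : G.Var → ℝ) : G.Branch dissipator → ℝ := part dissipator (by decide) x

/-- Currents of all the dissipators from the mixed representation. -/
def dissCurrent (D : G.Data) (w : G.Branch dissipator → ℝ) : G.Branch dissipator → ℝ :=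
  fun e => if G.kind e.1 = resistor then w e else D.ρ w e

/-- Voltages of all the dissipators from the mixed representation. -/
def dissVoltage (D : G.Data) (w : G.Branch dissipator → ℝ) : G.Branch dissipator → ℝ :=
  fun e => if G.kind e.1 = resistor then D.ρ w e else w e

/-- The prescribed voltages of the controlled voltage sources in terms of `(t, x)`. -/
noncomputable def gammaV (D : G.Data) (t : ℝ) (x : G.Var → ℝ) : G.Branch {ctrlVoltage} → ℝ :=
  D.lawV (t, grad D.HC (charge x), D.V t, grad D.HL (flux x), D.I t)

/-- The prescribed currents of the controlled current sources in terms of `(t, x)`. -/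
noncomputable def gammaI (D : G.Data) (t : ℝ) (x : G.Var → ℝ) : G.Branch {ctrlCurrent} → ℝ :=
  D.lawI (t, grad D.HC (charge x), D.V t, D.dissVoltage (dissVar x),
    grad D.HL (flux x), D.I t, D.dissCurrent (dissVar x))

/-- All the branch currents. The currents of the independent voltage sources are outputs; they
occur in no equation of the DAE below (all voltage sources are twigs), so the value `0` is a
placeholder. -/
noncomputable def current (D : G.Data) (t : ℝ) (x xp : G.Var → ℝ) (e : ε) : ℝ :=
  if h : G.kind e ∈ ({capacitor} : Finset Kind) then charge xp ⟨e, h⟩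
  else if h : G.kind e ∈ ({inductor} : Finset Kind) then grad D.HL (flux x) ⟨e, h⟩
  else if h : G.kind e ∈ dissipator then D.dissCurrent (dissVar x) ⟨e, h⟩
  else if h : G.kind e ∈ controlled then x (Sum.inr ⟨e, h⟩)
  else if h : G.kind e ∈ ({indepCurrent} : Finset Kind) then D.I t ⟨e, h⟩
  else 0

/-- All the branch voltages. The voltages of the independent current sources are outputs; they
occur in no equation of the DAE below (all current sources are links), so the value `0` is a
placeholder. -/
noncomputable def voltage (D : G.Data) (t : ℝ) (x xp : G.Var → ℝ) (e : ε) : ℝ :=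
  if h : G.kind e ∈ ({capacitor} : Finset Kind) then grad D.HC (charge x) ⟨e, h⟩
  else if h : G.kind e ∈ ({inductor} : Finset Kind) then flux xp ⟨e, h⟩
  else if h : G.kind e ∈ dissipator then D.dissVoltage (dissVar x) ⟨e, h⟩
  else if h : G.kind e ∈ controlled then x (Sum.inl ⟨e, controlled_subset h⟩)
  else if h : G.kind e ∈ ({indepVoltage} : Finset Kind) then D.V t ⟨e, h⟩
  else 0

/-- Kirchhoff residual of the edge `e` with respect to the tree `T`: for a twig the current law
`i_T - Fᵀ i_N` across its fundamental cutset, for a link the voltage law `v_N + F v_T` round its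
fundamental cycle. -/
noncomputable def kirchhoff (D : G.Data) (T : Finset ε) (t : ℝ) (x xp : G.Var → ℝ) (e : ε) : ℝ :=
  if h : e ∈ T then
    D.current t x xp e -
      ∑ l : {l : ε // l ∉ T}, G.ccMatrix T l ⟨e, h⟩ * D.current t x xp l
  else
    D.voltage t x xp e +
      ∑ b : {b : ε // b ∈ T}, G.ccMatrix T ⟨e, h⟩ b * D.voltage t x xp b

/-- Residual of the law of a controlled source: `v - γ_v` or `i - γ_I`. -/
noncomputable def sourceLaw (D : G.Data) (t : ℝ) (x : G.Var → ℝ) (e : G.Branch controlled) : ℝ :=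
  if h : G.kind e.1 ∈ ({ctrlVoltage} : Finset Kind) then
    x (Sum.inl ⟨e.1, controlled_subset e.2⟩) - D.gammaV t x ⟨e.1, h⟩
  else
    x (Sum.inr e) - D.gammaI t x ⟨e.1, ctrlCurrent_of e.2 h⟩

/-- The compact port-Hamiltonian (CpH) DAE of the circuit (state equation, sources given): the Kirchhoff
equations of all the edges other than independent sources and the laws of the controlled
sources. -/
noncomputable def system (D : G.Data) (T : Finset ε) : Dae.System G.Var :=
  fun t x xp => Sum.elim (fun e => D.kirchhoff T t x xp e.1) (fun e => D.sourceLaw t x e)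

/-- The set of `(t, x)` where the system is considered. -/
def domain (D : G.Data) : Set (ℝ × (G.Var → ℝ)) := {p | p.1 ∈ D.𝕋 ∧ dissVar p.2 ∈ D.Ω}

/-! ### Assumptions -/

/-- Standing regularity: the time interval is a nondegenerate interval, the source functions and
the laws of the controlled sources are continuously differentiable. -/
structure Regular (D : G.Data) : Prop where
  interval : D.𝕋.OrdConnected
  nontrivial : D.𝕋.Nontrivial
  V : ContDiffOn ℝ 1 D.V D.𝕋
  I : ContDiffOn ℝ 1 D.I D.𝕋
  lawV : ContDiffOn ℝ 1 D.lawV (D.𝕋 ×ˢ Set.univ)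
  lawI : ContDiffOn ℝ 1 D.lawI (D.𝕋 ×ˢ Set.univ)

/-- The Hamiltonian `HC + HL` is twice continuously differentiable with pointwise positive definite
Hessians of both parts. -/
structure StoragePassive (D : G.Data) : Prop where
  contDiff_HC : ContDiff ℝ 2 D.HC
  contDiff_HL : ContDiff ℝ 2 D.HL
  hessian_HC : ∀ q, IsPD (hessian D.HC q)
  hessian_HL : ∀ φ, IsPD (hessian D.HL φ)

/-- The dissipators are described by a continuously differentiable implicit relation
`r(i, v) = 0` such that `(∂r/∂i, ∂r/∂v)` is a positive definite matrix pair at each `(i, v)`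
which satisfies the relation. -/
structure DissipatorsPassive (D : G.Data) : Prop where
  contDiff : ContDiff ℝ 1 (fun p : _ × _ => D.r p.1 p.2)
  pair : ∀ i v, D.r i v = 0 → IsPDPair (jacobian (fun i' => D.r i' v) i) (jacobian (D.r i) v)

/-- The relation `r(i, v) = 0` is represented on the open set `Ω` in the mixed form
`(v_R, i_G) = ρ(i_R, v_G)` with `ρ` continuously differentiable. -/
structure MixedForm (D : G.Data) : Prop where
  isOpen : IsOpen D.Ω
  contDiffOn : ContDiffOn ℝ 1 D.ρ D.Ω
  represents : ∀ w ∈ D.Ω, D.r (D.dissCurrent w) (D.dissVoltage w) = 0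

end Network.Data

end Circuit

set_option linter.unusedSectionVars false

/-! ### Systems affine in the derivative, with algebraic rows: solvability and index. -/

namespace Dae

open Set Filter Topology

/-! The circuit equations have the form `L ẋ + h(t, x) = 0` with a constant matrix `L`, because
derivatives enter only as capacitor currents and inductor voltages, linearly and through Kirchhoff's
laws. The argument has two halves, joined by the structure `IsSemiExplicit`.

Analysis. Let `a` be a set of rows in which `L` vanishes. Suppose that the rows of `L` outside `a`,
together with the rows of `∂h/∂x` in `a`, form an invertible matrix. Differentiating exactly the
rows in `a` once then gives a linear system for `ẋ` with a unique solution, continuous in `(t, x)`.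
If `a` is empty, this is an ODE. If `a` is not empty, the square matrix `L` has a zero row, hence a
kernel, so the undifferentiated equations cannot determine `ẋ`, and the index is exactly one.

Circuit. The rows outside `a` are those of capacitor twigs and inductor links. The other rows
contain no derivatives because blocks of the cycle-cutset matrix vanish (`rateMap_eq_zero`): the
rank conditions of a normal tree confine the fundamental cycles of capacitor and dissipator links,
and the cycle and cutset conditions deal with the controlled sources. Invertibility
(`eq_zero_of_linearization_eq_zero`) comes from Tellegen's theorem, applied to three subcircuits of
the linearized circuit. For a kernel vector, the capacitors give `yᵀ H y = 0` with a positive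
definite Hessian `H`, so the charges vanish. The inductors are dual. The laws of the controlled
voltage sources then remove their voltages, after which strict passivity of the linearized
dissipators removes `w`. The remaining unknowns of the controlled sources follow from their laws and
single Kirchhoff equations. -/

theorem jetCurve_one {ι : Type*} (t : ℝ) (X : Fin 2 → ι → ℝ) :
    jetCurve t X = fun s => X 0 + (s - t) • X 1 := by
  funext s
  simp [jetCurve, Fin.sum_univ_two]

theorem jetCurve_two {ι : Type*} (t : ℝ) (X : Fin 3 → ι → ℝ) :
    jetCurve t X = fun s => X 0 + (s - t) • X 1 + ((s - t) ^ 2 / 2) • X 2 := by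
  funext s
  simp [jetCurve, Fin.sum_univ_three]

/-- Projection onto the coordinates in `s`. -/
noncomputable def coordProj {ι : Type*} (s : Set ι) : (ι → ℝ) →L[ℝ] (ι → ℝ) :=
  open Classical in ContinuousLinearMap.pi fun i => if i ∈ s then ContinuousLinearMap.proj i else 0

theorem coordProj_of_mem {ι : Type*} {s : Set ι} {i : ι} (hi : i ∈ s) (y : ι → ℝ) : coordProj s y i = y i := by
  simp [coordProj, hi]

theorem coordProj_of_notMem {ι : Type*} {s : Set ι} {i : ι} (hi : i ∉ s) (y : ι → ℝ) :
    coordProj s y i = 0 := by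
  simp [coordProj, hi]

section

variable {ι : Type*} {L : (ι → ℝ) →L[ℝ] (ι → ℝ)} {h : ℝ × (ι → ℝ) → (ι → ℝ)}

/-- The rows of `L` outside `a`, and the rows of the `x`-derivative of `h` in `a`. -/
noncomputable def solveMap (S : Set (ℝ × (ι → ℝ))) (L : (ι → ℝ) →L[ℝ] (ι → ℝ))
    (h : ℝ × (ι → ℝ) → (ι → ℝ)) (a : Set ι) (p : ℝ × (ι → ℝ)) : (ι → ℝ) →L[ℝ] (ι → ℝ) :=
  (coordProj aᶜ).comp L +
    (coordProj a).comp ((fderivWithin ℝ h S p).comp (ContinuousLinearMap.inr ℝ ℝ (ι → ℝ)))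

/-- Right-hand side belonging to `solveMap`. -/
noncomputable def solveRhs (S : Set (ℝ × (ι → ℝ))) (h : ℝ × (ι → ℝ) → (ι → ℝ)) (a : Set ι)
    (p : ℝ × (ι → ℝ)) : ι → ℝ :=
  -(coordProj aᶜ (h p) + coordProj a (fderivWithin ℝ h S p (1, 0)))

theorem solveMap_of_mem (S : Set (ℝ × (ι → ℝ))) {a : Set ι} {i : ι} (hi : i ∈ a)
    (p : ℝ × (ι → ℝ)) (y : ι → ℝ) :
    solveMap S L h a p y i = fderivWithin ℝ h S p (0, y) i := by
  simp [solveMap, coordProj_of_mem hi, coordProj_of_notMem (s := aᶜ) (not_not.2 hi)]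

theorem solveMap_of_notMem (S : Set (ℝ × (ι → ℝ))) {a : Set ι} {i : ι} (hi : i ∉ a)
    (p : ℝ × (ι → ℝ)) (y : ι → ℝ) : solveMap S L h a p y i = L y i := by
  simp [solveMap, coordProj_of_mem (s := aᶜ) hi, coordProj_of_notMem hi]

theorem solveRhs_of_mem (S : Set (ℝ × (ι → ℝ))) {a : Set ι} {i : ι} (hi : i ∈ a)
    (p : ℝ × (ι → ℝ)) : solveRhs S h a p i = -fderivWithin ℝ h S p (1, 0) i := by
  simp [solveRhs, coordProj_of_mem hi, coordProj_of_notMem (s := aᶜ) (not_not.2 hi)]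

theorem solveRhs_of_notMem (S : Set (ℝ × (ι → ℝ))) {a : Set ι} {i : ι} (hi : i ∉ a)
    (p : ℝ × (ι → ℝ)) : solveRhs S h a p i = -h p i := by
  simp [solveRhs, coordProj_of_mem (s := aᶜ) hi, coordProj_of_notMem hi]

end

section

variable {ι : Type*} [Fintype ι]

theorem deriv_jetCurve_one (t : ℝ) (X : Fin 2 → ι → ℝ) :
    deriv (jetCurve t X) = fun _ => X 1 := by
  funext s
  rw [jetCurve_one]
  have h : HasDerivAt (fun s : ℝ => s - t) 1 s := (hasDerivAt_id s).sub_const t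
  simpa using ((h.smul_const (X 1)).const_add (X 0)).deriv

theorem hasDerivAt_jetCurve_two (t : ℝ) (X : Fin 3 → ι → ℝ) (s : ℝ) :
    HasDerivAt (jetCurve t X) (X 1 + (s - t) • X 2) s := by
  rw [jetCurve_two]
  have h : HasDerivAt (fun s : ℝ => s - t) 1 s := (hasDerivAt_id s).sub_const t
  have h2 : HasDerivAt (fun s : ℝ => (s - t) ^ 2 / 2) (s - t) s := by
    simpa using (h.fun_pow 2).div_const 2
  simpa using ((h.smul_const (X 1)).const_add (X 0)).fun_add (h2.smul_const (X 2))

theorem deriv_jetCurve_two (t : ℝ) (X : Fin 3 → ι → ℝ) :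
    deriv (jetCurve t X) = fun s => X 1 + (s - t) • X 2 :=
  funext fun s => (hasDerivAt_jetCurve_two t X s).deriv

theorem uniqueDiffOn_of_nontrivial_ordConnected {𝕋 : Set ℝ} (h₁ : 𝕋.OrdConnected)
    (h₂ : 𝕋.Nontrivial) : UniqueDiffOn ℝ 𝕋 := by
  refine uniqueDiffOn_convex h₁.convex ?_
  obtain ⟨a, ha, b, hb, hab⟩ := h₂.exists_lt
  obtain ⟨c, hc⟩ := nonempty_Ioo.2 hab
  exact ⟨c, mem_interior.2 ⟨Ioo a b, Ioo_subset_Icc_self.trans (h₁.out ha hb), isOpen_Ioo, hc⟩⟩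

variable {𝕋 : Set ℝ} {W : Set (ι → ℝ)} {f : System ι} {L : (ι → ℝ) →L[ℝ] (ι → ℝ)}
  {h : ℝ × (ι → ℝ) → (ι → ℝ)}

/-- Total time derivative of an affine system along a jet. -/
theorem derivWithin_affine (h𝕋 : UniqueDiffOn ℝ 𝕋) (hW : IsOpen W)
    (hf : ∀ t x xp, f t x xp = L xp + h (t, x)) (hh : DifferentiableOn ℝ h (𝕋 ×ˢ W)) {t : ℝ}
    {X : Fin 3 → ι → ℝ} (hX : (t, X 0) ∈ 𝕋 ×ˢ W) (i : ι) :
    derivWithin (fun s => f s (jetCurve t X s) (deriv (jetCurve t X) s) i) 𝕋 t =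
      (L (X 2) + fderivWithin ℝ h (𝕋 ×ˢ W) (t, X 0) (1, X 1)) i := by
  refine HasDerivWithinAt.derivWithin ?_ (h𝕋 t hX.1)
  suffices hs : HasDerivWithinAt (fun s => f s (jetCurve t X s) (deriv (jetCurve t X) s))
      (L (X 2) + fderivWithin ℝ h (𝕋 ×ˢ W) (t, X 0) (1, X 1)) 𝕋 t from hasDerivWithinAt_pi.1 hs i
  simp only [hf, deriv_jetCurve_two]
  have hsub : HasDerivAt (fun s : ℝ => s - t) 1 t := (hasDerivAt_id t).sub_const t
  have h1 : HasDerivAt (fun s : ℝ => X 1 + (s - t) • X 2) (X 2) t := by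
    simpa using (hsub.smul_const (X 2)).const_add (X 1)
  have h0 : jetCurve t X t = X 0 := by simp [jetCurve_two]
  have hj : HasDerivAt (jetCurve t X) (X 1) t := by
    simpa using hasDerivAt_jetCurve_two t X t
  have hc : HasDerivWithinAt (fun s => (s, jetCurve t X s)) ((1 : ℝ), X 1)
      (𝕋 ∩ jetCurve t X ⁻¹' W) t :=
    ((hasDerivAt_id t).prodMk hj).hasDerivWithinAt
  have hd := (hh (t, X 0) hX).hasFDerivWithinAt
  rw [← h0] at hd
  have hcomp := hd.comp_hasDerivWithinAt t hc
    (show MapsTo _ (𝕋 ∩ jetCurve t X ⁻¹' W) (𝕋 ×ˢ W) from fun s hs => ⟨hs.1, hs.2⟩)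
  rw [h0] at hcomp
  -- The curve need not stay in `W` for all times in `𝕋`, but it does so near `t` because `W` is
  -- open, and only that matters for the derivative.
  have hcomp' := hcomp.mono_of_mem_nhdsWithin (show _ ∈ 𝓝[𝕋] t by
    refine inter_mem self_mem_nhdsWithin (mem_nhdsWithin_of_mem_nhds ?_)
    exact hj.continuousAt.preimage_mem_nhds (hW.mem_nhds (by rw [h0]; exact hX.2)))
  exact ((L.hasFDerivAt.comp_hasDerivAt t h1).hasDerivWithinAt).add hcomp'

theorem isUnit_of_ker_eq_zero {E : Type*} [NormedAddCommGroup E] [NormedSpace ℝ E]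
    [FiniteDimensional ℝ E] (A : E →L[ℝ] E) (hA : ∀ y, A y = 0 → y = 0) : IsUnit A := by
  have hinj : Function.Injective (A : E →ₗ[ℝ] E) :=
    (injective_iff_map_eq_zero (A : E →ₗ[ℝ] E)).2 hA
  let e := (LinearEquiv.ofInjectiveEndo (A : E →ₗ[ℝ] E) hinj).toContinuousLinearEquiv
  refine ⟨ContinuousLinearEquiv.toUnit e, ?_⟩
  ext y
  rfl

/-- A direction `(0, y)` leaves time fixed, and `W` is open. The derivative along it is therefore
two-sided even when `p.1` is an endpoint of `𝕋`. -/
theorem fderivWithin_slice (hW : IsOpen W)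
    (hh : DifferentiableOn ℝ h (𝕋 ×ˢ W)) {p : ℝ × (ι → ℝ)} (hp : p ∈ 𝕋 ×ˢ W) (y : ι → ℝ) (i : ι) :
    HasDerivAt (fun s : ℝ => h (p.1, p.2 + s • y) i) (fderivWithin ℝ h (𝕋 ×ˢ W) p (0, y) i) 0 := by
  suffices hs : HasDerivAt (fun s : ℝ => h (p.1, p.2 + s • y))
      (fderivWithin ℝ h (𝕋 ×ˢ W) p (0, y)) 0 from hasDerivAt_pi.1 hs i
  have hl : HasDerivAt (fun s : ℝ => p.2 + s • y) y 0 := by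
    simpa using ((hasDerivAt_id (0 : ℝ)).smul_const y).const_add p.2
  have hc : HasDerivWithinAt (fun s : ℝ => (p.1, p.2 + s • y)) ((0 : ℝ), y)
      ((fun s : ℝ => p.2 + s • y) ⁻¹' W) 0 :=
    ((hasDerivAt_const (0 : ℝ) p.1).prodMk hl).hasDerivWithinAt
  have hd := (hh p hp).hasFDerivWithinAt
  have h0 : p = (p.1, p.2 + (0 : ℝ) • y) := by simp
  have hd' : HasFDerivWithinAt h (fderivWithin ℝ h (𝕋 ×ˢ W) p) (𝕋 ×ˢ W)
      (p.1, p.2 + (0 : ℝ) • y) := h0 ▸ hd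
  refine (hd'.comp_hasDerivWithinAt (0 : ℝ) hc
    (show MapsTo _ ((fun s : ℝ => p.2 + s • y) ⁻¹' W) (𝕋 ×ˢ W) from
      fun s hs => ⟨hp.1, hs⟩)).hasDerivAt ?_
  exact hl.continuousAt.preimage_mem_nhds (hW.mem_nhds (by simpa using hp.2))

/-- The hypotheses under which a system `L ẋ + h(t, x) = 0` has index at most one: the rows of
`L` in `a` vanish, and `L` together with the linearization of these rows is injective. -/
structure IsSemiExplicit (𝕋 : Set ℝ) (W : Set (ι → ℝ)) (f : System ι)
    (L : (ι → ℝ) →L[ℝ] (ι → ℝ)) (h : ℝ × (ι → ℝ) → (ι → ℝ)) (a : Set ι) : Prop where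
  uniqueDiffOn : UniqueDiffOn ℝ 𝕋
  isOpen : IsOpen W
  eq_affine : ∀ t x xp, f t x xp = L xp + h (t, x)
  contDiffOn : ContDiffOn ℝ 1 h (𝕋 ×ˢ W)
  algebraic : ∀ i ∈ a, ∀ y, L y i = 0
  injective : ∀ p ∈ 𝕋 ×ˢ W, ∀ y, (∀ i ∉ a, L y i = 0) →
    (∀ i ∈ a, HasDerivAt (fun s : ℝ => h (p.1, p.2 + s • y) i) 0 0) → y = 0

namespace IsSemiExplicit

variable {a : Set ι} (H : IsSemiExplicit 𝕋 W f L h a)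
include H

theorem isUnit_solveMap {p : ℝ × (ι → ℝ)} (hp : p ∈ 𝕋 ×ˢ W) :
    IsUnit (solveMap (𝕋 ×ˢ W) L h a p) := by
  refine isUnit_of_ker_eq_zero _ fun y hy => ?_
  refine H.injective p hp y (fun i hi => ?_) (fun i hi => ?_)
  · rw [← solveMap_of_notMem (𝕋 ×ˢ W) hi p, hy, Pi.zero_apply]
  · have := fderivWithin_slice H.isOpen
      (H.contDiffOn.differentiableOn one_ne_zero) hp y i
    rwa [← solveMap_of_mem (L := L) (𝕋 ×ˢ W) hi p, hy] at this

/-- Inversion of operators is continuous at units, and `fderivWithin` of the `C¹` map `h` is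
continuous up to the endpoints of `𝕋`. -/
theorem continuousOn_solution :
    ContinuousOn (fun p => Ring.inverse (solveMap (𝕋 ×ˢ W) L h a p) (solveRhs (𝕋 ×ˢ W) h a p))
      (𝕋 ×ˢ W) := by
  have hd : ContinuousOn (fderivWithin ℝ h (𝕋 ×ˢ W)) (𝕋 ×ˢ W) :=
    H.contDiffOn.continuousOn_fderivWithin (H.uniqueDiffOn.prod H.isOpen.uniqueDiffOn) le_rfl
  refine ContinuousOn.clm_apply (fun p hp => ?_) ?_
  · obtain ⟨u, hu⟩ := H.isUnit_solveMap hp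
    have hinv : ContinuousAt Ring.inverse (solveMap (𝕋 ×ˢ W) L h a p) :=
      hu ▸ NormedRing.inverse_continuousAt u
    refine hinv.comp_continuousWithinAt ?_
    refine (continuousOn_const.add (continuousOn_const.clm_comp ?_)) p hp
    exact hd.clm_comp continuousOn_const
  · refine ContinuousOn.neg (ContinuousOn.add ?_ ?_)
    · exact (coordProj aᶜ).continuous.comp_continuousOn H.contDiffOn.continuousOn
    · exact (coordProj a).continuous.comp_continuousOn (hd.clm_apply continuousOn_const)

/-- Identifies the candidate for `ẋ`: it solves the original rows outside `a` and the once
differentiated rows in `a`. In the latter the second derivative of `x` does not occur, since `L`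
vanishes there. -/
theorem eq_solution_iff {p : ℝ × (ι → ℝ)} (hp : p ∈ 𝕋 ×ˢ W) (y : ι → ℝ) :
    y = Ring.inverse (solveMap (𝕋 ×ˢ W) L h a p) (solveRhs (𝕋 ×ˢ W) h a p) ↔
      (∀ i ∉ a, L y i + h p i = 0) ∧
        ∀ i ∈ a, fderivWithin ℝ h (𝕋 ×ˢ W) p (1, y) i = 0 := by
  have hu := H.isUnit_solveMap hp
  have h1 : y = Ring.inverse (solveMap (𝕋 ×ˢ W) L h a p) (solveRhs (𝕋 ×ˢ W) h a p) ↔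
      solveMap (𝕋 ×ˢ W) L h a p y = solveRhs (𝕋 ×ˢ W) h a p := by
    constructor
    · intro hy
      rw [hy, ← mul_apply_eq_comp, Ring.mul_inverse_cancel _ hu]
      rfl
    · intro hy
      rw [← hy, ← mul_apply_eq_comp, Ring.inverse_mul_cancel _ hu]
      rfl
  have h2 : ∀ i, fderivWithin ℝ h (𝕋 ×ˢ W) p (1, y) i =
      fderivWithin ℝ h (𝕋 ×ˢ W) p (0, y) i + fderivWithin ℝ h (𝕋 ×ˢ W) p (1, 0) i := by
    intro i
    rw [← Pi.add_apply, ← map_add]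
    simp
  rw [h1, funext_iff]
  constructor
  · intro hy
    refine ⟨fun i hi => ?_, fun i hi => ?_⟩
    · have := hy i
      rw [solveMap_of_notMem _ hi, solveRhs_of_notMem _ hi] at this
      linarith
    · have := hy i
      rw [solveMap_of_mem _ hi, solveRhs_of_mem _ hi] at this
      rw [h2]
      linarith
  · rintro ⟨hy1, hy2⟩ i
    by_cases hi : i ∈ a
    · rw [solveMap_of_mem _ hi, solveRhs_of_mem _ hi]
      linarith [hy2 i hi, h2 i]
    · rw [solveMap_of_notMem _ hi, solveRhs_of_notMem _ hi]
      linarith [hy1 i hi]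

theorem isODE (ha : a = ∅) : IsODE (𝕋 ×ˢ W) f := by
  refine ⟨_, H.continuousOn_solution, fun t x hp xp => ?_⟩
  rw [H.eq_solution_iff hp, H.eq_affine, funext_iff]
  simp [ha]

theorem exists_solution {p : ℝ × (ι → ℝ)} (hp : p ∈ 𝕋 ×ˢ W) (z : ι → ℝ) :
    ∃ y, ∀ i ∉ a, L y i = z i := by
  obtain ⟨u, hu⟩ := H.isUnit_solveMap hp
  refine ⟨(↑u⁻¹ : (ι → ℝ) →L[ℝ] (ι → ℝ)) z, fun i hi => ?_⟩
  rw [← solveMap_of_notMem (h := h) (𝕋 ×ˢ W) hi p, ← hu, ← mul_apply_eq_comp,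
    Units.mul_inv]
  rfl

theorem exists_derivativeArray {t : ℝ} {x : ι → ℝ} (hp : (t, x) ∈ 𝕋 ×ˢ W)
    (hc : ∃ xp, f t x xp = 0) :
    ∃ X : Fin 3 → ι → ℝ, X 0 = x ∧ DerivativeArray 𝕋 f (fun _ => 1) t X := by
  obtain ⟨y, hy⟩ : ∃ y, y = Ring.inverse (solveMap (𝕋 ×ˢ W) L h a (t, x))
    (solveRhs (𝕋 ×ˢ W) h a (t, x)) := ⟨_, rfl⟩
  rw [H.eq_solution_iff hp] at hy
  -- The value of `ẍ` must satisfy the differentiated rows outside `a`. The differentiated rows in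
  -- `a` do not involve it.
  obtain ⟨z, hz⟩ := H.exists_solution hp (-fderivWithin ℝ h (𝕋 ×ˢ W) (t, x) (1, y))
  refine ⟨![x, y, z], rfl, fun i k hk => ?_⟩
  obtain rfl | rfl : k = 0 ∨ k = 1 := Nat.le_one_iff_eq_zero_or_eq_one.1 hk
  · rw [iteratedDerivWithin_zero]
    rw [deriv_jetCurve_two, jetCurve_two, H.eq_affine]
    by_cases hi : i ∈ a
    -- The rows in `a` constrain only `(t, x)`. They hold for the chosen `y` because they hold for
    -- some `xp`.
    · obtain ⟨xp, hxp⟩ := hc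
      have := congrFun hxp i
      rw [H.eq_affine] at this
      simp only [Pi.add_apply, H.algebraic i hi] at this
      simpa [H.algebraic i hi] using this
    · simpa using hy.1 i hi
  · rw [iteratedDerivWithin_one,
      derivWithin_affine H.uniqueDiffOn H.isOpen H.eq_affine
        (H.contDiffOn.differentiableOn one_ne_zero) (X := ![x, y, z]) hp]
    change L z i + fderivWithin ℝ h (𝕋 ×ˢ W) (t, x) (1, y) i = 0
    by_cases hi : i ∈ a
    · rw [H.algebraic i hi, hy.2 i hi, add_zero]
    · rw [hz i hi]
      simp

theorem solvesToODE_one (U : Set (ℝ × (ι → ℝ))) :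
    ∃ c : ι → ℕ, (∀ i, c i ≤ 1) ∧ SolvesToODE 𝕋 f c 1 (𝕋 ×ˢ W ∩ U) := by
  classical
  refine ⟨fun i => if i ∈ a then 1 else 0, fun i => by dsimp only; split_ifs <;> omega, _,
    H.continuousOn_solution.mono inter_subset_left, fun t X hX hA => ?_⟩
  rw [H.eq_solution_iff hX.1]
  refine ⟨fun i hi => ?_, fun i hi => ?_⟩
  · have := hA i 0 (Nat.zero_le _)
    rw [iteratedDerivWithin_zero] at this
    rw [deriv_jetCurve_two, jetCurve_two, H.eq_affine] at this
    simpa using this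
  · have := hA i 1 (by simp [hi])
    rwa [iteratedDerivWithin_one,
      derivWithin_affine H.uniqueDiffOn H.isOpen H.eq_affine
        (H.contDiffOn.differentiableOn one_ne_zero) hX.1, Pi.add_apply, H.algebraic i hi,
      zero_add] at this

/-- A zero row prevents the square matrix `L` from being surjective, hence from being injective.
Adding a kernel vector to one solution `ẋ` gives another at the same `(t, x)`. -/
theorem not_solvesToODE_zero {t : ℝ} {x : ι → ℝ} (hp : (t, x) ∈ 𝕋 ×ˢ W)
    (hc : ∃ xp, f t x xp = 0) (ha : a.Nonempty) {c : ι → ℕ} (hc0 : ∀ i, c i ≤ 0)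
    {U : Set (ℝ × (ι → ℝ))} (hU : U ∈ 𝓝 (t, x)) : ¬ SolvesToODE 𝕋 f c 0 (𝕋 ×ˢ W ∩ U) := by
  rintro ⟨φ, -, hφ⟩
  have key : ∀ xp, f t x xp = 0 → xp = φ (t, x) := by
    intro xp hxp
    refine hφ t ![x, xp] ⟨hp, mem_of_mem_nhds hU⟩ fun i k hk => ?_
    obtain rfl : k = 0 := by have := hc0 i; omega
    rw [iteratedDerivWithin_zero]
    rw [deriv_jetCurve_one, jetCurve_one]
    simpa using congrFun hxp i
  obtain ⟨i, hi⟩ := ha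
  have hninj : ¬ Function.Injective (L : (ι → ℝ) →ₗ[ℝ] (ι → ℝ)) := by
    intro hinj
    classical
    obtain ⟨y, hy⟩ := LinearMap.injective_iff_surjective.1 hinj (Pi.single i 1)
    have := congrFun hy i
    rw [ContinuousLinearMap.coe_coe, H.algebraic i hi] at this
    simp at this
  obtain ⟨xp, hxp⟩ := hc
  refine hninj ((injective_iff_map_eq_zero _).2 fun y hy => ?_)
  have h1 := key xp hxp
  have h2 := key (xp + y) (by
    rw [H.eq_affine] at hxp ⊢
    rw [map_add, show L y = 0 from hy, add_zero, hxp])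
  rw [h1] at h2
  simpa using h2

theorem hasIndexAt_one (ha : a.Nonempty) {t : ℝ} {x : ι → ℝ} (hp : (t, x) ∈ 𝕋 ×ˢ W)
    (hc : ∃ xp, f t x xp = 0) : HasIndexAt 𝕋 (𝕋 ×ˢ W) f t x 1 := by
  refine ⟨hp, H.exists_derivativeArray hp hc, ?_, ?_⟩
  · obtain ⟨c, hc1, hc2⟩ := H.solvesToODE_one univ
    exact ⟨c, hc1, univ, univ_mem, hc2⟩
  · rintro μ ⟨c, hcμ, U, hU, hs⟩
    by_contra hμ
    obtain rfl : μ = 0 := by omega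
    exact H.not_solvesToODE_zero hp hc ha hcμ hU hs

end IsSemiExplicit

end

end Dae

/-! ### Cycles and separating cuts in the circuit graph. -/

namespace Circuit

namespace Network

variable {𝒱 ε : Type*} {G : Network 𝒱 ε}

theorem Joins.symm {e : ε} {u v : 𝒱} (h : G.Joins e u v) : G.Joins e v u := Or.symm h

theorem Joins.eq_or_eq {e : ε} {u v u' v' : 𝒱} (h : G.Joins e u v) (h' : G.Joins e u' v') :
    (u = u' ∧ v = v') ∨ (u = v' ∧ v = u') := by
  rcases h with ⟨rfl, rfl⟩ | ⟨rfl, rfl⟩ <;> rcases h' with ⟨rfl, rfl⟩ | ⟨rfl, rfl⟩ <;> simp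

/-- The simple graph of adjacency via edges in `S`. -/
def adjGraph (G : Network 𝒱 ε) (S : Finset ε) : SimpleGraph 𝒱 where
  Adj u v := ∃ e ∈ S, G.Joins e u v
  symm := ⟨fun _ _ ⟨e, he, h⟩ => ⟨e, he, h.symm⟩⟩
  loopless := ⟨fun _ ⟨e, _, h⟩ => by
    rcases h with ⟨h, h'⟩ | ⟨h, h'⟩ <;> exact G.tail_ne_head e (h.trans h'.symm)⟩

/-- A path in `S` between the ends of an edge outside `S` closes up to a cycle. -/
theorem exists_isCycle_of_reachable [DecidableEq ε] {S : Finset ε} {j : ε} (hj : j ∉ S)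
    (h : (G.adjGraph S).Reachable (G.tail j) (G.head j)) :
    ∃ C, G.IsCycle C ∧ C ⊆ insert j S ∧ j ∈ C := by
  classical
  obtain ⟨p, hp⟩ := h.exists_isPath
  have hstep : ∀ i, i < p.length → ∃ e ∈ S, G.Joins e (p.getVert i) (p.getVert (i + 1)) :=
    fun i hi => p.adj_getVert_succ hi
  have : Nonempty ε := ⟨j⟩
  choose! e heS heJ using hstep
  have hinj : ∀ {a b}, a ≤ p.length → b ≤ p.length → p.getVert a = p.getVert b → a = b :=
    fun ha hb hab => hp.getVert_injOn ha hb hab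
  -- The path edges come first. The last index carries `j`, which leads from the end of the path
  -- back to its start.
  let E : Fin (p.length + 1) → ε := fun i => if (i : ℕ) < p.length then e i else j
  have hE : ∀ i, E i ∈ insert j S := by
    intro i
    by_cases hi : (i : ℕ) < p.length
    · simp [E, hi, heS i hi]
    · simp [E, hi]
  have hEj : E (Fin.last _) = j := by simp [E]
  refine ⟨Finset.univ.image E, ⟨p.length, fun i => p.getVert i, E, ?_, ?_, ?_, rfl⟩, ?_, ?_⟩
  · intro a b hab
    exact Fin.ext (hinj (by omega) (by omega) hab)
  · intro a b hab
    by_cases ha : (a : ℕ) < p.length <;> by_cases hb : (b : ℕ) < p.length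
    · have hab' : e a = e b := by simpa [E, ha, hb] using hab
      rcases (heJ a ha).eq_or_eq (hab' ▸ heJ b hb) with ⟨h1, -⟩ | ⟨h1, h2⟩
      · exact Fin.ext (hinj (by omega) (by omega) h1)
      -- One edge traversed in both directions would force `a = b + 1` and `a + 1 = b`.
      · have h3 := hinj (by omega) (by omega) h1
        have h4 := hinj (by omega) (by omega) h2
        omega
    · have hab' : e a = j := by simpa [E, ha, hb] using hab
      exact absurd (hab' ▸ heS a ha) hj
    · have hab' : j = e b := by simpa [E, ha, hb] using hab
      exact absurd (hab' ▸ heS b hb) hj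
    · exact Fin.ext (by omega)
  · intro i
    by_cases hi : (i : ℕ) < p.length
    · have hv : ((i + 1 : Fin (p.length + 1)) : ℕ) = i + 1 :=
        Fin.val_add_one_of_lt (Fin.lt_last_iff_ne_last.2 fun h => by simp [h] at hi)
      simpa [E, hi, hv] using heJ i hi
    -- Here the cyclic successor wraps round to `0`, and `j` is traversed from head to tail.
    · obtain rfl : i = Fin.last _ := Fin.ext (by simp; omega)
      rw [hEj, Fin.last_add_one]
      exact Or.inr ⟨by simp, by simp⟩
  · intro x hx
    obtain ⟨i, -, rfl⟩ := Finset.mem_image.1 hx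
    exact hE i
  · exact Finset.mem_image.2 ⟨_, Finset.mem_univ _, hEj⟩

/-- An edge `j` which lies on no cycle of `insert j S` is separated by a cut without edges of
`S`. -/
theorem exists_separating_set [Fintype 𝒱] [DecidableEq ε] {S : Finset ε} {j : ε} (hj : j ∉ S)
    (h : ∀ C, G.IsCycle C → C ⊆ insert j S → j ∉ C) :
    ∃ W : Finset 𝒱, G.tail j ∈ W ∧ G.head j ∉ W ∧ ∀ e ∈ S, (G.tail e ∈ W ↔ G.head e ∈ W) := by
  classical
  refine ⟨Finset.univ.filter fun u => (G.adjGraph S).Reachable (G.tail j) u, ?_, ?_, ?_⟩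
  · simp
  · simp only [Finset.mem_filter, Finset.mem_univ, true_and]
    intro hr
    obtain ⟨C, hC, hCS, hjC⟩ := exists_isCycle_of_reachable hj hr
    exact h C hC hCS hjC
  · intro e he
    have hadj : (G.adjGraph S).Adj (G.tail e) (G.head e) := ⟨e, he, Or.inl ⟨rfl, rfl⟩⟩
    simp only [Finset.mem_filter, Finset.mem_univ, true_and]
    exact ⟨fun h' => h'.trans hadj.reachable, fun h' => h'.trans hadj.symm.reachable⟩

/-! ### Cuts as linear functionals on the incidence columns. -/

variable [DecidableEq 𝒱]

/-- Column of the incidence matrix. -/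
def column (G : Network 𝒱 ε) (e : ε) : 𝒱 → ℝ := fun u => G.incidence u e

/-- Sum of the entries in `W`. -/
def cutForm (W : Finset 𝒱) : (𝒱 → ℝ) →ₗ[ℝ] ℝ := ∑ u ∈ W, LinearMap.proj u

theorem cutForm_column (W : Finset 𝒱) (e : ε) :
    cutForm W (G.column e) =
      (if G.tail e ∈ W then 1 else 0) - (if G.head e ∈ W then 1 else 0) := by
  have h : ∀ u, G.column e u = (if u = G.tail e then 1 else 0) - (if u = G.head e then 1 else 0) := by
    intro u
    have := G.tail_ne_head e
    simp only [column, incidence, Matrix.of_apply]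
    split_ifs <;> simp_all
  simp [cutForm, h, Finset.sum_sub_distrib]

theorem cutForm_column_eq_zero_iff (W : Finset 𝒱) (e : ε) :
    cutForm W (G.column e) = 0 ↔ (G.tail e ∈ W ↔ G.head e ∈ W) := by
  rw [cutForm_column]
  split_ifs <;> simp_all

variable [Fintype 𝒱] [Fintype ε] [DecidableEq ε] {T : Finset ε}

/-- The fundamental cut of a twig. -/
theorem IsTree.exists_fundamental_cut (hT : G.IsTree T) {j : ε} (hj : j ∈ T) :
    ∃ W : Finset 𝒱, G.tail j ∈ W ∧ G.head j ∉ W ∧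
      ∀ e ∈ T, e ≠ j → cutForm W (G.column e) = 0 := by
  obtain ⟨W, h1, h2, h3⟩ := exists_separating_set (G := G) (Finset.notMem_erase j T)
    fun C hC hCT _ => hT.2 C hC (by rwa [Finset.insert_erase hj] at hCT)
  exact ⟨W, h1, h2, fun e he hej =>
    (cutForm_column_eq_zero_iff W e).2 (h3 e (Finset.mem_erase.2 ⟨hej, he⟩))⟩

theorem cutForm_ne_zero {W : Finset 𝒱} {j : ε} (h1 : G.tail j ∈ W) (h2 : G.head j ∉ W) :
    cutForm W (G.column j) ≠ 0 := by
  rw [Ne, cutForm_column_eq_zero_iff]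
  tauto

/-- The functional of the fundamental cut of a twig kills all other twig columns but not its own, so
it isolates one coefficient of a linear relation. -/
theorem IsTree.linearIndependent_column (hT : G.IsTree T) :
    LinearIndependent ℝ fun e : T => G.column e := by
  refine Fintype.linearIndependent_iff.2 fun g hg j => ?_
  obtain ⟨W, h1, h2, h3⟩ := hT.exists_fundamental_cut j.2
  have h4 := congrArg (cutForm W) hg
  rw [map_sum, map_zero, Finset.sum_eq_single j] at h4
  · rw [map_smul, smul_eq_mul] at h4
    exact (mul_eq_zero.1 h4).resolve_right (cutForm_ne_zero h1 h2)
  · intro e _ hej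
    rw [map_smul, h3 e e.2 (fun h => hej (Subtype.ext h)), smul_zero]
  · simp

theorem mem_edges {K : Finset Kind} {e : ε} : e ∈ G.edges K ↔ G.kind e ∈ K := by
  simp [edges]

theorem rk_eq_finrank_span (K : Finset Kind) :
    G.rk K = Module.finrank ℝ (Submodule.span ℝ (G.column '' (G.edges K : Set ε))) := by
  rw [rk, Matrix.rank_eq_finrank_span_cols]
  have h : Set.range (G.incidence.submatrix id (Subtype.val : G.Branch K → ε)).col =
      G.column '' (G.edges K : Set ε) := by
    ext y
    constructor
    · rintro ⟨e, rfl⟩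
      exact ⟨e.1, mem_edges.2 e.2, rfl⟩
    · rintro ⟨e, he, rfl⟩
      exact ⟨⟨e, mem_edges.1 he⟩, rfl⟩
  rw [h]

theorem IsTree.finrank_span_twigs (hT : G.IsTree T) (K : Finset Kind) :
    Module.finrank ℝ (Submodule.span ℝ (G.column '' ((G.edges K ∩ T : Finset ε) : Set ε))) =
      G.nTwig T K := by
  have hli : LinearIndependent ℝ fun e : (G.edges K ∩ T : Finset ε) => G.column e :=
    hT.linearIndependent_column.comp
      (fun e : (G.edges K ∩ T : Finset ε) => (⟨e, (Finset.mem_inter.1 e.2).2⟩ : T))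
      fun a b hab => Subtype.ext (congrArg (fun z : T => (z : ε)) hab)
  have := finrank_span_eq_card hli
  rw [Fintype.card_coe] at this
  rw [nTwig, ← this, Set.image_eq_range]
  rfl

/-- The twig columns are independent, so their number is the dimension of their span. A subspace of
full dimension is everything. -/
theorem IsTree.span_twigs_eq (hT : G.IsTree T) {K : Finset Kind} (hK : G.nTwig T K = G.rk K) :
    Submodule.span ℝ (G.column '' ((G.edges K ∩ T : Finset ε) : Set ε)) =
      Submodule.span ℝ (G.column '' (G.edges K : Set ε)) := by
  refine Submodule.eq_of_le_of_finrank_eq ?_ ?_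
  · exact Submodule.span_mono (Set.image_mono (Finset.coe_subset.2 Finset.inter_subset_left))
  · rw [hT.finrank_span_twigs, ← rk_eq_finrank_span, hK]

/-- Evaluating a cut functional on `a_i = -∑ F_ik a_k` leaves one term. Vanishing is required only
on twigs with nonzero coefficient, so that cuts other than the fundamental ones are admissible too.
-/
theorem ExpressesLinks.cutForm_eq {F : Matrix {e : ε // e ∉ T} {e : ε // e ∈ T} ℝ}
    (hF : G.ExpressesLinks T F) (i : {e : ε // e ∉ T}) {j : {e : ε // e ∈ T}} {W : Finset 𝒱}
    (hW : ∀ k, k ≠ j → F i k ≠ 0 → cutForm W (G.column k) = 0) :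
    cutForm W (G.column i) = -(F i j * cutForm W (G.column j)) := by
  have h : G.column i = -∑ k : {e : ε // e ∈ T}, F i k • G.column k := by
    funext u
    simpa [column] using hF i u
  rw [h, map_neg, map_sum, Finset.sum_eq_single j]
  · rw [map_smul, smul_eq_mul]
  · intro k _ hk
    by_cases h0 : F i k = 0
    · simp [h0]
    · rw [map_smul, hW k hk h0, smul_zero]
  · simp

/-- The statements below about vanishing entries are trivial in the second case, so the existence of
the expansion is not needed for them. -/
theorem ccMatrix_cases (G : Network 𝒱 ε) (T : Finset ε) :
    G.ExpressesLinks T (G.ccMatrix T) ∨ G.ccMatrix T = 0 := by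
  by_cases h : ∃ F, G.ExpressesLinks T F
  · exact Or.inl (by rw [ccMatrix, dif_pos h]; exact h.choose_spec)
  · exact Or.inr (by rw [ccMatrix, dif_neg h])

/-- If the twigs of kind in `K` span all the columns of kind in `K`, then the fundamental cycles
of the links of kind in `K` use only twigs of kind in `K`. -/
theorem IsTree.ccMatrix_eq_zero_of_rk (hT : G.IsTree T) {K : Finset Kind}
    (hK : G.nTwig T K = G.rk K) (i : {e : ε // e ∉ T}) (j : {e : ε // e ∈ T})
    (hi : G.kind i ∈ K) (hj : G.kind j ∉ K) : G.ccMatrix T i j = 0 := by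
  rcases G.ccMatrix_cases T with hF | hF
  swap
  · rw [hF]; rfl
  obtain ⟨W, h1, h2, h3⟩ := hT.exists_fundamental_cut j.2
  have h4 := hF.cutForm_eq i (j := j) (W := W)
    fun k hk _ => h3 k k.2 fun h => hk (Subtype.ext h)
  -- Since `j` is not of kind in `K`, its fundamental cut functional kills all `K`-twigs. It
  -- therefore kills the span of all `K`-columns, which contains the column of `i`.
  have hle : Submodule.span ℝ (G.column '' ((G.edges K ∩ T : Finset ε) : Set ε)) ≤
      LinearMap.ker (cutForm W) := by
    rw [Submodule.span_le]
    rintro _ ⟨e, he, rfl⟩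
    have he' := Finset.mem_inter.1 (Finset.mem_coe.1 he)
    exact h3 e he'.2 (by rintro rfl; exact hj (mem_edges.1 he'.1))
  rw [hT.span_twigs_eq hK] at hle
  have h5 : cutForm W (G.column i) = 0 :=
    hle (Submodule.subset_span ⟨i, Finset.mem_coe.2 (mem_edges.2 hi), rfl⟩)
  rw [h5, eq_comm, neg_eq_zero] at h4
  exact (mul_eq_zero.1 h4).resolve_right (cutForm_ne_zero h1 h2)

theorem nTwig_union {K K' : Finset Kind} (h : Disjoint K K') :
    G.nTwig T (K ∪ K') = G.nTwig T K + G.nTwig T K' := by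
  rw [nTwig, nTwig, nTwig, ← Finset.card_union_of_disjoint]
  · congr 1
    ext e
    simp only [Finset.mem_inter, Finset.mem_union, mem_edges]
    tauto
  · rw [Finset.disjoint_left]
    intro e he he'
    simp only [Finset.mem_inter, mem_edges] at he he'
    exact Finset.disjoint_left.1 h he.1 he'.1

/-! ### Zero blocks of the cycle-cutset matrix of a normal tree. -/

open Kind

namespace IsNormalTree

/-- All voltage sources are twigs, so their columns are independent. Adding the rank differences in
the definition of a normal tree then yields the two larger classes. -/
theorem nTwig_voltage (hT : G.IsNormalTree T) : G.nTwig T voltage = G.rk voltage := by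
  rw [← hT.isTree.finrank_span_twigs, rk_eq_finrank_span,
    Finset.inter_eq_left.2 hT.voltage_subset]

theorem nTwig_voltage_capacitor (hT : G.IsNormalTree T) :
    G.nTwig T (voltage ∪ {capacitor}) = G.rk (voltage ∪ {capacitor}) := by
  rw [nTwig_union (by decide), hT.nTwig_voltage, ← hT.capacitors, add_comm]

theorem nTwig_voltage_capacitor_dissipator (hT : G.IsNormalTree T) :
    G.nTwig T (voltage ∪ {capacitor} ∪ dissipator) =
      G.rk (voltage ∪ {capacitor} ∪ dissipator) := by
  rw [nTwig_union (by decide), hT.nTwig_voltage_capacitor, ← hT.dissipators, add_comm]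

theorem ccMatrix_capacitor_link (hT : G.IsNormalTree T) {i : {e : ε // e ∉ T}}
    {j : {e : ε // e ∈ T}} (hi : G.kind i = capacitor) (hj : G.kind j ∉ voltage ∪ {capacitor}) :
    G.ccMatrix T i j = 0 :=
  hT.isTree.ccMatrix_eq_zero_of_rk hT.nTwig_voltage_capacitor i j (by rw [hi]; decide) hj

theorem ccMatrix_dissipator_link (hT : G.IsNormalTree T) {i : {e : ε // e ∉ T}}
    {j : {e : ε // e ∈ T}} (hi : G.kind i ∈ dissipator)
    (hj : G.kind j ∉ voltage ∪ {capacitor} ∪ dissipator) : G.ccMatrix T i j = 0 :=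
  hT.isTree.ccMatrix_eq_zero_of_rk hT.nTwig_voltage_capacitor_dissipator i j
    (Finset.mem_union_right _ hi) hj

/-- By `hVS`, the edge `j` lies on no cycle of capacitors and voltage sources, so some cut contains
`j` and no other capacitor or voltage source. The column of the capacitor link `i` expands in twigs
of these kinds only. The cut functional kills it and every contributing twig except `j`, which
forces the coefficient of `j` to be zero. -/
theorem ccMatrix_capacitor_ctrlVoltage (hT : G.IsNormalTree T)
    (hVS : ∀ C, G.IsCycle C → C ⊆ G.edges (insert capacitor voltage) →
      Disjoint C (G.edges {ctrlVoltage}))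
    {i : {e : ε // e ∉ T}} {j : {e : ε // e ∈ T}} (hi : G.kind i = capacitor)
    (hj : G.kind j = ctrlVoltage) : G.ccMatrix T i j = 0 := by
  rcases G.ccMatrix_cases T with hF | hF
  swap
  · rw [hF]; rfl
  obtain ⟨W, h1, h2, h3⟩ := exists_separating_set (G := G)
    (Finset.notMem_erase j.1 (G.edges (insert capacitor voltage))) fun C hC hCS hjC => by
      rw [Finset.insert_erase (mem_edges.2 (by rw [hj]; decide))] at hCS
      exact Finset.disjoint_left.1 (hVS C hC hCS) hjC (mem_edges.2 (by rw [hj]; decide))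
  have h4 := hF.cutForm_eq i (j := j) (W := W) fun k hk hFk => by
    refine (cutForm_column_eq_zero_iff W _).2 (h3 k (Finset.mem_erase.2
      ⟨fun h => hk (Subtype.ext h), mem_edges.2 ?_⟩))
    by_contra hk'
    refine hFk (hT.ccMatrix_capacitor_link hi fun h => hk' ?_)
    simp only [Finset.mem_union, Finset.mem_insert, Finset.mem_singleton] at h ⊢
    tauto
  have h5 : cutForm W (G.column i) = 0 :=
    (cutForm_column_eq_zero_iff W _).2 (h3 i (Finset.mem_erase.2
      ⟨fun h => i.2 (h ▸ j.2), mem_edges.2 (by rw [hi]; decide)⟩))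
  rw [h5, eq_comm, neg_eq_zero] at h4
  exact (mul_eq_zero.1 h4).resolve_right (cutForm_ne_zero h1 h2)

/-- The fundamental cutset of the inductor twig `j` consists of `j` and the links `k` with nonzero
entry `(k, j)`. Voltage sources are never links, and capacitor and dissipator links have zero
entries. Only inductors and current sources remain, so `hCS` excludes controlled current sources
from this cutset. -/
theorem ccMatrix_ctrlCurrent_inductor (hT : G.IsNormalTree T)
    (hCS : ∀ C, G.IsCutset C → C ⊆ G.edges (insert inductor current) →
      Disjoint C (G.edges {ctrlCurrent}))
    {i : {e : ε // e ∉ T}} {j : {e : ε // e ∈ T}} (hi : G.kind i = ctrlCurrent)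
    (hj : G.kind j = inductor) : G.ccMatrix T i j = 0 := by
  rcases G.ccMatrix_cases T with hF | hF
  swap
  · rw [hF]; rfl
  obtain ⟨W, h1, h2, h3⟩ := hT.isTree.exists_fundamental_cut j.2
  have h4 : ∀ k : {e : ε // e ∉ T}, cutForm W (G.column k) = -(G.ccMatrix T k j * cutForm W (G.column j)) :=
    fun k => hF.cutForm_eq k fun l hl _ => h3 l l.2 fun h => hl (Subtype.ext h)
  have hcut : G.IsCutset (Finset.univ.filter fun e => ¬(G.tail e ∈ W ↔ G.head e ∈ W)) :=
    ⟨W, ⟨_, h1⟩, ⟨_, Finset.mem_compl.2 h2⟩, fun e => by simp⟩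
  have hsub : (Finset.univ.filter fun e => ¬(G.tail e ∈ W ↔ G.head e ∈ W)) ⊆
      G.edges (insert inductor current) := by
    intro e he
    rw [Finset.mem_filter, ← cutForm_column_eq_zero_iff] at he
    rw [mem_edges]
    by_cases heT : e ∈ T
    · by_cases hej : e = j
      · rw [hej, hj]; decide
      · exact absurd (h3 e heT hej) he.2
    · have hne : G.ccMatrix T ⟨e, heT⟩ j ≠ 0 := fun h0 => he.2 ((h4 ⟨e, heT⟩).trans (by simp [h0]))
      have hv : G.kind e ∉ voltage := fun h => heT (hT.voltage_subset (mem_edges.2 h))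
      have hc : G.kind e ≠ capacitor := fun h =>
        hne (hT.ccMatrix_capacitor_link (i := ⟨e, heT⟩) h (by rw [hj]; decide))
      have hd : G.kind e ∉ dissipator := fun h =>
        hne (hT.ccMatrix_dissipator_link (i := ⟨e, heT⟩) h (by rw [hj]; decide))
      revert hv hc hd
      generalize G.kind e = k
      cases k <;> decide
  by_contra hne
  refine (Finset.disjoint_left.1 (hCS _ hcut hsub) : ∀ ⦃e⦄, _) (?_ : i.1 ∈ _)
    (mem_edges.2 (by simp [hi]))
  rw [Finset.mem_filter, ← cutForm_column_eq_zero_iff, h4 i]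
  exact ⟨Finset.mem_univ _, neg_ne_zero.2 (mul_ne_zero hne (cutForm_ne_zero h1 h2))⟩

end IsNormalTree

end Network

end Circuit

/-! ### Directional derivatives, Kirchhoff residuals and Tellegen's theorem. -/

namespace Circuit

open Filter Topology

section Calculus

variable {κ : Type*} [Fintype κ]

theorem hasDerivAt_add_smul (z y : κ → ℝ) : HasDerivAt (fun s : ℝ => z + s • y) y 0 := by
  simpa using ((hasDerivAt_id (0 : ℝ)).smul_const y).const_add z

variable [DecidableEq κ]

theorem sum_smul_single (y : κ → ℝ) : ∑ l, y l • (Pi.single l 1 : κ → ℝ) = y := by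
  funext k
  simp [Finset.sum_apply, Pi.single_apply]

theorem jacobian_mulVec (g : (κ → ℝ) → (κ → ℝ)) (z y : κ → ℝ) :
    (jacobian g z).mulVec y = fderiv ℝ g z y := by
  funext k
  conv_rhs => rw [← sum_smul_single y]
  simp [Matrix.mulVec, dotProduct, jacobian, Finset.sum_apply, mul_comm]

theorem hessian_mulVec (H : (κ → ℝ) → ℝ) (z y : κ → ℝ) (k : κ) :
    (hessian H z).mulVec y k = fderiv ℝ (fun w => grad H w k) z y := by
  conv_rhs => rw [← sum_smul_single y]
  simp [Matrix.mulVec, dotProduct, hessian, mul_comm]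

theorem contDiff_grad {H : (κ → ℝ) → ℝ} (hH : ContDiff ℝ 2 H) : ContDiff ℝ 1 (grad H) := by
  refine contDiff_pi.2 fun k => ?_
  exact (hH.fderiv_right (m := 1) (by norm_num)).clm_apply contDiff_const

theorem hasDerivAt_grad {H : (κ → ℝ) → ℝ} (hH : ContDiff ℝ 2 H) (z y : κ → ℝ) (k : κ) :
    HasDerivAt (fun s : ℝ => grad H (z + s • y) k) ((hessian H z).mulVec y k) 0 := by
  rw [hessian_mulVec]
  have h : DifferentiableAt ℝ (fun w => grad H w k) (z + (0 : ℝ) • y) :=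
    (contDiff_pi.1 (contDiff_grad hH) k).differentiable one_ne_zero _
  have := h.hasFDerivAt.comp_hasDerivAt (0 : ℝ) (hasDerivAt_add_smul z y)
  simp only [zero_smul, add_zero] at this
  exact this

end Calculus

namespace Network

variable {𝒱 ε : Type*} [Fintype 𝒱] [DecidableEq 𝒱] [Fintype ε] [DecidableEq ε]
  {G : Network 𝒱 ε}

open Kind

/-- Extension by zero of a quantity defined on the edges of kind in `K`. -/
def extend (G : Network 𝒱 ε) (K : Finset Kind) (z : G.Branch K → ℝ) (e : ε) : ℝ :=
  if h : G.kind e ∈ K then z ⟨e, h⟩ else 0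

theorem extend_of_mem {K : Finset Kind} (z : G.Branch K → ℝ) {e : ε} (h : G.kind e ∈ K) :
    G.extend K z e = z ⟨e, h⟩ := dif_pos h

theorem extend_of_notMem {K : Finset Kind} (z : G.Branch K → ℝ) {e : ε} (h : G.kind e ∉ K) :
    G.extend K z e = 0 := dif_neg h

theorem sum_extend_mul_extend (K : Finset Kind) (z z' : G.Branch K → ℝ) :
    ∑ e, G.extend K z e * G.extend K z' e = z ⬝ᵥ z' := by
  rw [dotProduct, ← Finset.sum_subset (Finset.subset_univ (G.edges K)),
    Finset.sum_subtype (G.edges K) (fun e => mem_edges (G := G))]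
  · refine Finset.sum_congr rfl fun e _ => ?_
    rw [extend_of_mem _ e.2, extend_of_mem _ e.2]
  · intro e _ he
    rw [extend_of_notMem _ fun h => he (mem_edges.2 h), zero_mul]

/-- Residual of Kirchhoff's laws for given branch currents and voltages. -/
noncomputable def residual (G : Network 𝒱 ε) (T : Finset ε) (i v : ε → ℝ) (e : ε) : ℝ :=
  if h : e ∈ T then i e - ∑ l : {l : ε // l ∉ T}, G.ccMatrix T l ⟨e, h⟩ * i l
  else v e + ∑ b : {b : ε // b ∈ T}, G.ccMatrix T ⟨e, h⟩ b * v b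

variable {T : Finset ε}

theorem residual_twig (i v : ε → ℝ) {e : ε} (h : e ∈ T) :
    G.residual T i v e = i e - ∑ l : {l : ε // l ∉ T}, G.ccMatrix T l ⟨e, h⟩ * i l := dif_pos h

theorem residual_link (i v : ε → ℝ) {e : ε} (h : e ∉ T) :
    G.residual T i v e = v e + ∑ b : {b : ε // b ∈ T}, G.ccMatrix T ⟨e, h⟩ b * v b := dif_neg h

theorem residual_add (i v i' v' : ε → ℝ) (e : ε) :
    G.residual T (i + i') (v + v') e = G.residual T i v e + G.residual T i' v' e := by
  unfold residual
  split_ifs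
  · simp only [Pi.add_apply, mul_add, Finset.sum_add_distrib]
    ring
  · simp only [Pi.add_apply, mul_add, Finset.sum_add_distrib]
    ring

theorem residual_smul (c : ℝ) (i v : ε → ℝ) (e : ε) :
    G.residual T (c • i) (c • v) e = c * G.residual T i v e := by
  unfold residual
  split_ifs
  · simp only [Pi.smul_apply, smul_eq_mul, mul_sub, Finset.mul_sum, mul_left_comm]
  · simp only [Pi.smul_apply, smul_eq_mul, mul_add, Finset.mul_sum, mul_left_comm]

/-- Two sets of branch quantities have the same residual at a twig if the currents agree there and
at all the links of its fundamental cutset. -/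
theorem residual_congr_twig {i v i' v' : ε → ℝ} {e : ε} (h : e ∈ T) (he : i e = i' e)
    (hl : ∀ l : {l : ε // l ∉ T}, G.ccMatrix T l ⟨e, h⟩ = 0 ∨ i l = i' l) :
    G.residual T i v e = G.residual T i' v' e := by
  rw [residual_twig _ _ h, residual_twig _ _ h, he]
  congr 1
  refine Finset.sum_congr rfl fun l _ => ?_
  rcases hl l with h0 | h0 <;> simp [h0]

/-- Two sets of branch quantities have the same residual at a link if the voltages agree there and
at all the twigs of its fundamental cycle. -/
theorem residual_congr_link {i v i' v' : ε → ℝ} {e : ε} (h : e ∉ T) (he : v e = v' e)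
    (hb : ∀ b : {b : ε // b ∈ T}, G.ccMatrix T ⟨e, h⟩ b = 0 ∨ v b = v' b) :
    G.residual T i v e = G.residual T i' v' e := by
  rw [residual_link _ _ h, residual_link _ _ h, he]
  congr 1
  refine Finset.sum_congr rfl fun b _ => ?_
  rcases hb b with h0 | h0 <;> simp [h0]

/-- Tellegen's theorem for currents and voltages supported on the edges of kind in `K`. -/
theorem tellegen {K : Finset Kind} {i v : G.Branch K → ℝ}
    (h : ∀ e, G.kind e ∈ K → G.residual T (G.extend K i) (G.extend K v) e = 0) : i ⬝ᵥ v = 0 := by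
  -- The current laws turn the sum over twigs into the double sum of `F_le i_l v_e`. The voltage
  -- laws turn the sum over links into its negative.
  rw [← sum_extend_mul_extend, ← Finset.sum_add_sum_compl T,
    Finset.sum_subtype T (fun e => Iff.rfl),
    Finset.sum_subtype Tᶜ (p := fun e => e ∉ T) (fun e => Finset.mem_compl)]
  have h1 : ∀ e : {e : ε // e ∈ T}, G.extend K i e * G.extend K v e =
      ∑ l : {l : ε // l ∉ T}, G.ccMatrix T l e * G.extend K i l * G.extend K v e := by
    intro e
    by_cases he : G.kind e ∈ K
    · have := h e he
      rw [residual_twig _ _ e.2, sub_eq_zero] at this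
      rw [this, Finset.sum_mul]
    · simp [extend_of_notMem _ he]
  have h2 : ∀ l : {l : ε // l ∉ T}, G.extend K i l * G.extend K v l =
      -∑ e : {e : ε // e ∈ T}, G.ccMatrix T l e * G.extend K i l * G.extend K v e := by
    intro l
    by_cases hl : G.kind l ∈ K
    · have := h l hl
      rw [residual_link _ _ l.2, add_eq_zero_iff_eq_neg] at this
      rw [this, mul_neg, Finset.mul_sum]
      congr 1
      exact Finset.sum_congr rfl fun e _ => by ring
    · simp [extend_of_notMem _ hl]
  rw [Finset.sum_congr rfl fun e _ => h1 e, Finset.sum_congr rfl fun l _ => h2 l,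
    Finset.sum_neg_distrib, Finset.sum_comm, add_neg_cancel]

theorem contDiffOn_residual {E : Type*} [NormedAddCommGroup E] [NormedSpace ℝ E] {S : Set E}
    {i v : E → ε → ℝ} (hi : ∀ e, ContDiffOn ℝ 1 (fun p => i p e) S)
    (hv : ∀ e, ContDiffOn ℝ 1 (fun p => v p e) S) (e : ε) :
    ContDiffOn ℝ 1 (fun p => G.residual T (i p) (v p) e) S := by
  unfold residual
  split_ifs
  · exact (hi e).sub (ContDiffOn.sum fun l _ => contDiffOn_const.mul (hi l))
  · exact (hv e).add (ContDiffOn.sum fun b _ => contDiffOn_const.mul (hv b))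

theorem hasDerivAt_residual {i v : ℝ → ε → ℝ} {i' v' : ε → ℝ} {s : ℝ}
    (hi : ∀ e, HasDerivAt (fun p => i p e) (i' e) s)
    (hv : ∀ e, HasDerivAt (fun p => v p e) (v' e) s) (e : ε) :
    HasDerivAt (fun p => G.residual T (i p) (v p) e) (G.residual T i' v' e) s := by
  unfold residual
  split_ifs
  · exact (hi e).fun_sub (HasDerivAt.fun_sum fun l _ => (hi l).const_mul _)
  · exact (hv e).fun_add (HasDerivAt.fun_sum fun b _ => (hv b).const_mul _)

/-! ### The circuit equations as a system affine in the derivatives. -/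

namespace Data

/-- The part of the branch currents which depends on the derivatives of the unknowns. -/
def rateCurrent (y : G.Var → ℝ) : ε → ℝ := G.extend {capacitor} (charge y)

/-- The part of the branch voltages which depends on the derivatives of the unknowns. -/
def rateVoltage (y : G.Var → ℝ) : ε → ℝ := G.extend {inductor} (flux y)

theorem rateCurrent_of_ne (y : G.Var → ℝ) {e : ε} (h : G.kind e ≠ capacitor) :
    rateCurrent y e = 0 := extend_of_notMem _ (by simpa using h)

theorem rateVoltage_of_ne (y : G.Var → ℝ) {e : ε} (h : G.kind e ≠ inductor) :
    rateVoltage y e = 0 := extend_of_notMem _ (by simpa using h)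

/-- Only capacitor currents involve derivatives, so inserting `0` for `xp` isolates everything else.
For voltages the same holds with inductors. -/
theorem current_eq (D : G.Data) (t : ℝ) (x xp : G.Var → ℝ) :
    D.current t x xp = rateCurrent xp + D.current t x 0 := by
  funext e
  by_cases h : G.kind e ∈ ({capacitor} : Finset Kind)
  · simp [current, rateCurrent, extend, h, charge, part]
  · simp [current, rateCurrent, extend, h]

theorem voltage_eq (D : G.Data) (t : ℝ) (x xp : G.Var → ℝ) :
    D.voltage t x xp = rateVoltage xp + D.voltage t x 0 := by
  funext e
  by_cases h : G.kind e ∈ ({inductor} : Finset Kind)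
  · have h' : G.kind e ∉ ({capacitor} : Finset Kind) := by
      rw [Finset.mem_singleton] at h
      rw [h]
      decide
    simp [voltage, rateVoltage, extend, h, h', flux, part]
  · simp [voltage, rateVoltage, extend, h]

/-- The part of the system which is linear in the derivatives of the unknowns. -/
noncomputable def rateMap (G : Network 𝒱 ε) (T : Finset ε) :
    (G.Var → ℝ) →L[ℝ] (G.Var → ℝ) :=
  LinearMap.toContinuousLinearMap
    { toFun := fun y => Sum.elim
        (fun e => G.residual T (rateCurrent y) (rateVoltage y) e.1) fun _ => 0
      map_add' := fun y z => by
        have h1 : rateCurrent (y + z) = rateCurrent y + rateCurrent z := by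
          funext e
          by_cases h : G.kind e ∈ ({capacitor} : Finset Kind) <;>
            simp [rateCurrent, extend, h, charge, part]
        have h2 : rateVoltage (y + z) = rateVoltage y + rateVoltage z := by
          funext e
          by_cases h : G.kind e ∈ ({inductor} : Finset Kind) <;>
            simp [rateVoltage, extend, h, flux, part]
        funext i
        cases i <;> simp [h1, h2, residual_add]
      map_smul' := fun c y => by
        have h1 : rateCurrent (c • y) = c • rateCurrent y := by
          funext e
          by_cases h : G.kind e ∈ ({capacitor} : Finset Kind) <;>
            simp [rateCurrent, extend, h, charge, part]
        have h2 : rateVoltage (c • y) = c • rateVoltage y := by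
          funext e
          by_cases h : G.kind e ∈ ({inductor} : Finset Kind) <;>
            simp [rateVoltage, extend, h, flux, part]
        funext i
        cases i <;> simp [h1, h2, residual_smul] }

theorem rateMap_inl (y : G.Var → ℝ) (e : G.Branch internal) :
    rateMap G T y (Sum.inl e) = G.residual T (rateCurrent y) (rateVoltage y) e.1 := rfl

theorem rateMap_inr (y : G.Var → ℝ) (e : G.Branch controlled) :
    rateMap G T y (Sum.inr e) = 0 := rfl

theorem system_eq (D : G.Data) (t : ℝ) (x xp : G.Var → ℝ) :
    D.system T t x xp = rateMap G T xp + D.system T t x 0 := by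
  funext i
  rcases i with e | e
  · change G.residual T (D.current t x xp) (D.voltage t x xp) e.1 =
      G.residual T (rateCurrent xp) (rateVoltage xp) e.1 +
        G.residual T (D.current t x 0) (D.voltage t x 0) e.1
    rw [D.current_eq, D.voltage_eq, residual_add]
  · simp [system, rateMap_inr]

/-- The equations in which derivatives occur: those of the capacitor twigs and of the inductor
links. -/
def IsDifferential (T : Finset ε) (e : G.Branch internal) : Prop :=
  (G.kind e = capacitor ∧ e.1 ∈ T) ∨ (G.kind e = inductor ∧ e.1 ∉ T)

/-- The equations without derivatives. -/
def algebraicRows (G : Network 𝒱 ε) (T : Finset ε) : Set G.Var :=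
  {i | ∀ e, i = Sum.inl e → ¬ IsDifferential T e}

theorem inl_mem_algebraicRows {e : G.Branch internal} :
    Sum.inl e ∈ algebraicRows G T ↔ ¬ IsDifferential T e :=
  ⟨fun h => h e rfl, fun h _ he' => Sum.inl_injective he' ▸ h⟩

theorem inr_mem_algebraicRows (e : G.Branch controlled) : Sum.inr e ∈ algebraicRows G T := by
  simp [algebraicRows]

theorem contDiff_part (K : Finset Kind) (hK : K ⊆ internal) :
    ContDiff ℝ 1 (fun p : ℝ × (G.Var → ℝ) => part K hK p.2) :=
  contDiff_pi.2 fun _ => (contDiff_apply ℝ ℝ _).comp contDiff_snd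

theorem part_add_smul (K : Finset Kind) (hK : K ⊆ internal) (x y : G.Var → ℝ) (s : ℝ) :
    part K hK (x + s • y) = part K hK x + s • part K hK y := rfl

section Regularity

variable {D : G.Data}

theorem MixedForm.contDiffOn_dissCurrent (h : D.MixedForm) :
    ContDiffOn ℝ 1 D.dissCurrent D.Ω := by
  refine contDiffOn_pi.2 fun e => ?_
  unfold dissCurrent
  split_ifs
  · exact (contDiff_apply ℝ ℝ e).contDiffOn
  · exact contDiffOn_pi.1 h.contDiffOn e

theorem MixedForm.contDiffOn_dissVoltage (h : D.MixedForm) :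
    ContDiffOn ℝ 1 D.dissVoltage D.Ω := by
  refine contDiffOn_pi.2 fun e => ?_
  unfold dissVoltage
  split_ifs
  · exact contDiffOn_pi.1 h.contDiffOn e
  · exact (contDiff_apply ℝ ℝ e).contDiffOn

/-- The set of `x` where the system is considered. -/
def stateDomain (D : G.Data) : Set (G.Var → ℝ) := {x | dissVar x ∈ D.Ω}

theorem contDiffOn_dissVar_comp {F : (G.Branch dissipator → ℝ) → (G.Branch dissipator → ℝ)}
    (hF : ContDiffOn ℝ 1 F D.Ω) :
    ContDiffOn ℝ 1 (fun p : ℝ × (G.Var → ℝ) => F (dissVar p.2)) (D.𝕋 ×ˢ D.stateDomain) :=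
  hF.comp (contDiff_part _ _).contDiffOn fun _ hp => hp.2

theorem StoragePassive.contDiff_grad_HC (h : D.StoragePassive) :
    ContDiff ℝ 1 (fun p : ℝ × (G.Var → ℝ) => grad D.HC (charge p.2)) :=
  (contDiff_grad h.contDiff_HC).comp (contDiff_part _ _)

theorem StoragePassive.contDiff_grad_HL (h : D.StoragePassive) :
    ContDiff ℝ 1 (fun p : ℝ × (G.Var → ℝ) => grad D.HL (flux p.2)) :=
  (contDiff_grad h.contDiff_HL).comp (contDiff_part _ _)

theorem contDiffOn_time {E : Type*} [NormedAddCommGroup E] [NormedSpace ℝ E] {g : ℝ → E}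
    (hg : ContDiffOn ℝ 1 g D.𝕋) :
    ContDiffOn ℝ 1 (fun p : ℝ × (G.Var → ℝ) => g p.1) (D.𝕋 ×ˢ D.stateDomain) :=
  hg.comp contDiff_fst.contDiffOn fun _ hp => hp.1

variable (hreg : D.Regular) (hstore : D.StoragePassive) (hmix : D.MixedForm)
include hreg hstore

theorem contDiffOn_gammaV :
    ContDiffOn ℝ 1 (fun p : ℝ × (G.Var → ℝ) => D.gammaV p.1 p.2) (D.𝕋 ×ˢ D.stateDomain) :=
  hreg.lawV.comp (contDiff_fst.contDiffOn.prodMk (hstore.contDiff_grad_HC.contDiffOn.prodMk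
    ((contDiffOn_time hreg.V).prodMk (hstore.contDiff_grad_HL.contDiffOn.prodMk
      (contDiffOn_time hreg.I))))) fun _ hp => ⟨hp.1, trivial⟩

include hmix

theorem contDiffOn_gammaI :
    ContDiffOn ℝ 1 (fun p : ℝ × (G.Var → ℝ) => D.gammaI p.1 p.2) (D.𝕋 ×ˢ D.stateDomain) :=
  hreg.lawI.comp (contDiff_fst.contDiffOn.prodMk (hstore.contDiff_grad_HC.contDiffOn.prodMk
    ((contDiffOn_time hreg.V).prodMk
      ((contDiffOn_dissVar_comp hmix.contDiffOn_dissVoltage).prodMk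
        (hstore.contDiff_grad_HL.contDiffOn.prodMk ((contDiffOn_time hreg.I).prodMk
          (contDiffOn_dissVar_comp hmix.contDiffOn_dissCurrent))))))) fun _ hp => ⟨hp.1, trivial⟩

theorem contDiffOn_current (e : ε) :
    ContDiffOn ℝ 1 (fun p : ℝ × (G.Var → ℝ) => D.current p.1 p.2 0 e)
      (D.𝕋 ×ˢ D.stateDomain) := by
  unfold current
  split_ifs
  · exact contDiffOn_const
  · exact (contDiff_pi.1 hstore.contDiff_grad_HL _).contDiffOn
  · exact contDiffOn_pi.1 (contDiffOn_dissVar_comp hmix.contDiffOn_dissCurrent) _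
  · exact ((contDiff_apply ℝ ℝ _).comp contDiff_snd).contDiffOn
  · exact contDiffOn_pi.1 (contDiffOn_time hreg.I) _
  · exact contDiffOn_const

theorem contDiffOn_voltage (e : ε) :
    ContDiffOn ℝ 1 (fun p : ℝ × (G.Var → ℝ) => D.voltage p.1 p.2 0 e)
      (D.𝕋 ×ˢ D.stateDomain) := by
  unfold voltage
  split_ifs
  · exact (contDiff_pi.1 hstore.contDiff_grad_HC _).contDiffOn
  · exact contDiffOn_const
  · exact contDiffOn_pi.1 (contDiffOn_dissVar_comp hmix.contDiffOn_dissVoltage) _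
  · exact ((contDiff_apply ℝ ℝ _).comp contDiff_snd).contDiffOn
  · exact contDiffOn_pi.1 (contDiffOn_time hreg.V) _
  · exact contDiffOn_const

/-- The energies enter through their gradients only, which uses up one of their two derivatives. All
other data are `C¹`. -/
theorem contDiffOn_system :
    ContDiffOn ℝ 1 (fun p : ℝ × (G.Var → ℝ) => D.system T p.1 p.2 0)
      (D.𝕋 ×ˢ D.stateDomain) := by
  refine contDiffOn_pi.2 fun i => ?_
  rcases i with e | e
  · exact contDiffOn_residual (contDiffOn_current hreg hstore hmix)
      (contDiffOn_voltage hreg hstore hmix) e.1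
  · change ContDiffOn ℝ 1 (fun p : ℝ × (G.Var → ℝ) => D.sourceLaw p.1 p.2 e) _
    unfold sourceLaw
    split_ifs
    · exact ((contDiff_apply ℝ ℝ _).comp contDiff_snd).contDiffOn.sub
        (contDiffOn_pi.1 (contDiffOn_gammaV hreg hstore) _)
    · exact ((contDiff_apply ℝ ℝ _).comp contDiff_snd).contDiffOn.sub
        (contDiffOn_pi.1 (contDiffOn_gammaI hreg hstore hmix) _)

end Regularity

end Data

end Network

end Circuit

/-! ### Algebraic rows and injectivity of the linearized circuit. -/

namespace Circuit

open Filter Topology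

namespace Network

variable {𝒱 ε : Type*} [Fintype 𝒱] [DecidableEq 𝒱] [Fintype ε] [DecidableEq ε]
  {G : Network 𝒱 ε} {T : Finset ε}

open Kind

theorem IsNormalTree.ne_voltage (hT : G.IsNormalTree T) {e : ε} (he : e ∉ T) :
    G.kind e ≠ indepVoltage ∧ G.kind e ≠ ctrlVoltage := by
  constructor <;> intro h <;> exact he (hT.voltage_subset (mem_edges.2 (by rw [h]; decide)))

theorem IsNormalTree.ne_current (hT : G.IsNormalTree T) {e : ε} (he : e ∈ T) :
    G.kind e ≠ indepCurrent ∧ G.kind e ≠ ctrlCurrent := by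
  constructor <;> intro h <;>
    exact Finset.disjoint_left.1 hT.no_current (mem_edges.2 (by rw [h]; decide)) he

namespace Data

/-- Rows without derivatives do not see the derivatives of the unknowns. -/
theorem rateMap_eq_zero (hT : G.IsNormalTree T)
    (hVS : ∀ C, G.IsCycle C → C ⊆ G.edges (insert capacitor Kind.voltage) →
      Disjoint C (G.edges {ctrlVoltage}))
    (hCS : ∀ C, G.IsCutset C → C ⊆ G.edges (insert inductor Kind.current) →
      Disjoint C (G.edges {ctrlCurrent}))
    {i : G.Var} (hi : i ∈ algebraicRows G T) (y : G.Var → ℝ) : rateMap G T y i = 0 := by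
  rcases i with e | e
  swap
  · rfl
  rw [inl_mem_algebraicRows, IsDifferential] at hi
  rw [rateMap_inl]
  have hint := e.2
  by_cases he : e.1 ∈ T
  · have hec : G.kind e ≠ capacitor := fun h => hi (Or.inl ⟨h, he⟩)
    rw [residual_twig _ _ he, rateCurrent_of_ne y hec, Finset.sum_eq_zero, sub_zero]
    intro l _
    by_cases hl : G.kind l = capacitor
    · rw [mul_eq_zero]
      left
      by_cases hv : G.kind e = ctrlVoltage
      · exact hT.ccMatrix_capacitor_ctrlVoltage hVS hl hv
      · refine hT.ccMatrix_capacitor_link hl ?_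
        revert hint hec hv
        generalize G.kind e = k
        cases k <;> decide
    · rw [rateCurrent_of_ne y hl, mul_zero]
  · have hei : G.kind e ≠ inductor := fun h => hi (Or.inr ⟨h, he⟩)
    rw [residual_link _ _ he, rateVoltage_of_ne y hei, Finset.sum_eq_zero, add_zero]
    intro b _
    by_cases hb : G.kind b = inductor
    · rw [mul_eq_zero]
      left
      by_cases h1 : G.kind e = capacitor
      · exact hT.ccMatrix_capacitor_link h1 (by rw [hb]; decide)
      by_cases h2 : G.kind e ∈ dissipator
      · exact hT.ccMatrix_dissipator_link h2 (by rw [hb]; decide)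
      refine hT.ccMatrix_ctrlCurrent_inductor hCS ?_ hb
      have h3 := (hT.ne_voltage he).2
      revert hint hei h1 h2 h3
      generalize G.kind e = k
      cases k <;> decide
    · rw [rateVoltage_of_ne y hb, mul_zero]

/-- Directional derivative of the dissipator currents. -/
noncomputable def deltaDissCurrent (D : G.Data) (w z : G.Branch dissipator → ℝ) :
    G.Branch dissipator → ℝ :=
  fun e => if G.kind e.1 = resistor then z e else fderiv ℝ D.ρ w z e

/-- Directional derivative of the dissipator voltages. -/
noncomputable def deltaDissVoltage (D : G.Data) (w z : G.Branch dissipator → ℝ) :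
    G.Branch dissipator → ℝ :=
  fun e => if G.kind e.1 = resistor then fderiv ℝ D.ρ w z e else z e

theorem MixedForm.hasDerivAt_rho {D : G.Data} (h : D.MixedForm) {w : G.Branch dissipator → ℝ}
    (hw : w ∈ D.Ω) (z : G.Branch dissipator → ℝ) (e : G.Branch dissipator) :
    HasDerivAt (fun s : ℝ => D.ρ (w + s • z) e) (fderiv ℝ D.ρ w z e) 0 := by
  have hd : DifferentiableAt ℝ D.ρ (w + (0 : ℝ) • z) := by
    simpa using (h.contDiffOn.differentiableOn one_ne_zero).differentiableAt (h.isOpen.mem_nhds hw)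
  have := hd.hasFDerivAt.comp_hasDerivAt (0 : ℝ) (hasDerivAt_add_smul w z)
  simp only [zero_smul, add_zero] at this
  exact hasDerivAt_pi.1 this e

theorem MixedForm.hasDerivAt_dissCurrent {D : G.Data} (h : D.MixedForm)
    {w : G.Branch dissipator → ℝ} (hw : w ∈ D.Ω) (z : G.Branch dissipator → ℝ)
    (e : G.Branch dissipator) :
    HasDerivAt (fun s : ℝ => D.dissCurrent (w + s • z) e) (D.deltaDissCurrent w z e) 0 := by
  unfold dissCurrent deltaDissCurrent
  split_ifs
  · exact hasDerivAt_pi.1 (hasDerivAt_add_smul w z) e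
  · exact h.hasDerivAt_rho hw z e

theorem MixedForm.hasDerivAt_dissVoltage {D : G.Data} (h : D.MixedForm)
    {w : G.Branch dissipator → ℝ} (hw : w ∈ D.Ω) (z : G.Branch dissipator → ℝ)
    (e : G.Branch dissipator) :
    HasDerivAt (fun s : ℝ => D.dissVoltage (w + s • z) e) (D.deltaDissVoltage w z e) 0 := by
  unfold dissVoltage deltaDissVoltage
  split_ifs
  · exact h.hasDerivAt_rho hw z e
  · exact hasDerivAt_pi.1 (hasDerivAt_add_smul w z) e

/-- The linearized dissipators are strictly passive. -/
theorem eq_zero_of_dissipation_eq_zero {D : G.Data} (hdiss : D.DissipatorsPassive)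
    (hmix : D.MixedForm) {w : G.Branch dissipator → ℝ} (hw : w ∈ D.Ω)
    {z : G.Branch dissipator → ℝ} (hz : D.deltaDissCurrent w z ⬝ᵥ D.deltaDissVoltage w z = 0) :
    D.deltaDissCurrent w z = 0 ∧ D.deltaDissVoltage w z = 0 := by
  -- For a nonzero pair, positive definiteness would make the product positive. It remains to verify
  -- `B δi + B' δv = 0`, which results from differentiating `r = 0` along `w + s z`.
  by_contra hne
  refine absurd hz (hdiss.pair _ _ (hmix.represents w hw) _ _ hne ?_).ne'
  set R : (G.Branch dissipator → ℝ) × (G.Branch dissipator → ℝ) → (G.Branch dissipator → ℝ) :=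
    fun p => D.r p.1 p.2
  set i := D.dissCurrent w
  set v := D.dissVoltage w
  have hR : HasFDerivAt R (fderiv ℝ R (i, v)) (i, v) :=
    (hdiss.contDiff.differentiable one_ne_zero _).hasFDerivAt
  have h1 : fderiv ℝ (fun i' => D.r i' v) i =
      (fderiv ℝ R (i, v)).comp (ContinuousLinearMap.inl ℝ _ _) :=
    HasFDerivAt.fderiv (HasFDerivAt.comp (f := fun i' => (i', v)) i hR
      (hasFDerivAt_prodMk_left i v))
  have h2 : fderiv ℝ (D.r i) v = (fderiv ℝ R (i, v)).comp (ContinuousLinearMap.inr ℝ _ _) :=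
    HasFDerivAt.fderiv (HasFDerivAt.comp (f := fun v' => (i, v')) v hR
      (hasFDerivAt_prodMk_right i v))
  rw [jacobian_mulVec, jacobian_mulVec, h1, h2, ContinuousLinearMap.comp_apply,
    ContinuousLinearMap.comp_apply, ← map_add, ContinuousLinearMap.inl_apply,
    ContinuousLinearMap.inr_apply, Prod.mk_add_mk, add_zero, zero_add]
  have hc : HasDerivAt (fun s : ℝ => (D.dissCurrent (w + s • z), D.dissVoltage (w + s • z)))
      (D.deltaDissCurrent w z, D.deltaDissVoltage w z) 0 :=
    (hasDerivAt_pi.2 (hmix.hasDerivAt_dissCurrent hw z)).prodMk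
      (hasDerivAt_pi.2 (hmix.hasDerivAt_dissVoltage hw z))
  have hR' : HasFDerivAt R (fderiv ℝ R (i, v))
      (D.dissCurrent (w + (0 : ℝ) • z), D.dissVoltage (w + (0 : ℝ) • z)) := by
    simpa using hR
  refine (hR'.comp_hasDerivAt (0 : ℝ) hc).unique ((hasDerivAt_const (0 : ℝ) 0).congr_of_eventuallyEq ?_)
  have hnear : ∀ᶠ s : ℝ in 𝓝 0, w + s • z ∈ D.Ω :=
    (hasDerivAt_add_smul w z).continuousAt.preimage_mem_nhds (hmix.isOpen.mem_nhds (by simpa using hw))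
  filter_upwards [hnear] with s hs
  exact hmix.represents _ hs

/-- Directional derivative of the branch currents with respect to `x`. -/
noncomputable def deltaCurrent (D : G.Data) (x y : G.Var → ℝ) (e : ε) : ℝ :=
  if G.kind e ∈ ({capacitor} : Finset Kind) then 0
  else if h : G.kind e ∈ ({inductor} : Finset Kind) then
    (hessian D.HL (flux x)).mulVec (flux y) ⟨e, h⟩
  else if h : G.kind e ∈ dissipator then D.deltaDissCurrent (dissVar x) (dissVar y) ⟨e, h⟩
  else if h : G.kind e ∈ controlled then y (Sum.inr ⟨e, h⟩)
  else 0

/-- Directional derivative of the branch voltages with respect to `x`. -/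
noncomputable def deltaVoltage (D : G.Data) (x y : G.Var → ℝ) (e : ε) : ℝ :=
  if h : G.kind e ∈ ({capacitor} : Finset Kind) then
    (hessian D.HC (charge x)).mulVec (charge y) ⟨e, h⟩
  else if G.kind e ∈ ({inductor} : Finset Kind) then 0
  else if h : G.kind e ∈ dissipator then D.deltaDissVoltage (dissVar x) (dissVar y) ⟨e, h⟩
  else if h : G.kind e ∈ controlled then y (Sum.inl ⟨e, controlled_subset h⟩)
  else 0

section

variable {D : G.Data} (hstore : D.StoragePassive) (hmix : D.MixedForm)
include hstore hmix

theorem hasDerivAt_current (t : ℝ) {x : G.Var → ℝ} (hx : dissVar x ∈ D.Ω) (y : G.Var → ℝ) (e : ε) :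
    HasDerivAt (fun s : ℝ => D.current t (x + s • y) 0 e) (D.deltaCurrent x y e) 0 := by
  unfold current deltaCurrent
  split_ifs
  · exact hasDerivAt_const _ _
  · exact hasDerivAt_grad hstore.contDiff_HL _ _ _
  · exact hmix.hasDerivAt_dissCurrent hx _ _
  · exact hasDerivAt_pi.1 (hasDerivAt_add_smul x y) _
  · exact hasDerivAt_const _ _
  · exact hasDerivAt_const _ _

theorem hasDerivAt_voltage (t : ℝ) {x : G.Var → ℝ} (hx : dissVar x ∈ D.Ω) (y : G.Var → ℝ) (e : ε) :
    HasDerivAt (fun s : ℝ => D.voltage t (x + s • y) 0 e) (D.deltaVoltage x y e) 0 := by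
  unfold voltage deltaVoltage
  split_ifs
  · exact hasDerivAt_grad hstore.contDiff_HC _ _ _
  · exact hasDerivAt_const _ _
  · exact hmix.hasDerivAt_dissVoltage hx _ _
  · exact hasDerivAt_pi.1 (hasDerivAt_add_smul x y) _
  · exact hasDerivAt_const _ _
  · exact hasDerivAt_const _ _

end

/-- The linearization of the system at `x` in the direction `y`, with the differential rows
replaced by their dependence on `ẋ`, vanishes. -/
structure IsLinearizedSolution (D : G.Data) (T : Finset ε) (x y : G.Var → ℝ) : Prop where
  rate : ∀ e : G.Branch internal, IsDifferential T e →
    G.residual T (rateCurrent y) (rateVoltage y) e = 0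
  delta : ∀ e : G.Branch internal, ¬ IsDifferential T e →
    G.residual T (D.deltaCurrent x y) (D.deltaVoltage x y) e = 0

namespace IsLinearizedSolution

variable {D : G.Data} {x y : G.Var → ℝ} (h : IsLinearizedSolution D T x y)
  (hT : G.IsNormalTree T)
include h hT

/-- Tellegen's theorem is applied to the capacitors alone, with `charge y` as currents and the
Hessian times `charge y` as voltages. The current laws come from the differential rows of capacitor
twigs, the voltage laws from the linearized algebraic rows of capacitor links. The result is a
vanishing positive definite quadratic form. -/
theorem charge_eq_zero (hstore : D.StoragePassive)
    (hVS : ∀ C, G.IsCycle C → C ⊆ G.edges (insert capacitor Kind.voltage) →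
      Disjoint C (G.edges {ctrlVoltage})) : charge y = 0 := by
  by_contra hne
  refine (hstore.hessian_HC (charge x) _ hne).ne' (tellegen (T := T) fun e he => ?_)
  have hk : G.kind e = capacitor := by simpa using he
  have hint : G.kind e ∈ internal := by rw [hk]; decide
  by_cases heT : e ∈ T
  · rw [← h.rate ⟨e, hint⟩ (Or.inl ⟨hk, heT⟩)]
    exact residual_congr_twig heT rfl fun _ => Or.inr rfl
  · rw [← h.delta ⟨e, hint⟩ (by simp [IsDifferential, hk, heT])]
    refine residual_congr_link heT (by simp [extend, deltaVoltage, hk]) fun b => ?_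
    cases hb : G.kind b
    case capacitor => exact Or.inr (by simp [extend, deltaVoltage, hb])
    case indepVoltage => exact Or.inr (by simp [extend, deltaVoltage, hb])
    case ctrlVoltage => exact Or.inl (hT.ccMatrix_capacitor_ctrlVoltage hVS hk hb)
    all_goals exact Or.inl (hT.ccMatrix_capacitor_link hk (by rw [hb]; decide))

theorem flux_eq_zero (hstore : D.StoragePassive)
    (hCS : ∀ C, G.IsCutset C → C ⊆ G.edges (insert inductor Kind.current) →
      Disjoint C (G.edges {ctrlCurrent})) : flux y = 0 := by
  by_contra hne
  refine (hstore.hessian_HL (flux x) _ hne).ne' ?_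
  -- For inductors the roles are exchanged: `flux y` plays the voltages and its image under the
  -- Hessian the currents.
  rw [dotProduct_comm]
  refine tellegen (T := T) fun e he => ?_
  have hk : G.kind e = inductor := by simpa using he
  have hint : G.kind e ∈ internal := by rw [hk]; decide
  by_cases heT : e ∈ T
  · rw [← h.delta ⟨e, hint⟩ (by simp [IsDifferential, hk, heT])]
    refine residual_congr_twig heT (by simp [extend, deltaCurrent, hk]) fun l => ?_
    cases hl : G.kind l
    case resistor => exact Or.inl (hT.ccMatrix_dissipator_link (by rw [hl]; decide) (by rw [hk]; decide))
    case conductor => exact Or.inl (hT.ccMatrix_dissipator_link (by rw [hl]; decide) (by rw [hk]; decide))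
    case ctrlVoltage => exact absurd hl (hT.ne_voltage l.2).2
    case ctrlCurrent => exact Or.inl (hT.ccMatrix_ctrlCurrent_inductor hCS hl hk)
    all_goals exact Or.inr (by simp [extend, deltaCurrent, hl])
  · rw [← h.rate ⟨e, hint⟩ (Or.inr ⟨hk, heT⟩)]
    exact residual_congr_link heT rfl fun _ => Or.inr rfl

/-- Once charges, fluxes and controlled voltages are zero, only controlled current links could still
drive the dissipators. Their block `F_{I^c d}` is zero, so the linearized dissipators satisfy
Kirchhoff's laws among themselves, and Tellegen's theorem gives zero dissipated power. -/
theorem dissVar_eq_zero (hdiss : D.DissipatorsPassive) (hmix : D.MixedForm)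
    (hF : ∀ (l : {e : ε // e ∉ T}) (b : {e : ε // e ∈ T}),
      G.kind l = ctrlCurrent → G.kind b ∈ dissipator → G.ccMatrix T l b = 0)
    (hx : dissVar x ∈ D.Ω) (hq : charge y = 0) (hφ : flux y = 0)
    (hv : ∀ e : G.Branch internal, G.kind e = ctrlVoltage → y (Sum.inl e) = 0) :
    dissVar y = 0 := by
  obtain ⟨h1, h2⟩ := eq_zero_of_dissipation_eq_zero hdiss hmix hx (z := dissVar y) (by
    refine tellegen (T := T) fun e he => ?_
    have hint : G.kind e ∈ internal := by
      revert he
      generalize G.kind e = k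
      cases k <;> decide
    have hnd : ¬ IsDifferential T ⟨e, hint⟩ := by
      rintro (⟨hk, -⟩ | ⟨hk, -⟩) <;> simp [hk] at he
    have hnc : G.kind e ≠ capacitor := by rintro hk; simp [hk] at he
    have hni : G.kind e ≠ inductor := by rintro hk; simp [hk] at he
    rw [← h.delta ⟨e, hint⟩ hnd]
    by_cases heT : e ∈ T
    · refine residual_congr_twig heT ?_ fun l => ?_
      · rw [extend_of_mem _ he]
        simp only [deltaCurrent, Finset.mem_singleton, hnc, hni, if_false, dif_neg,
          not_false_eq_true, dif_pos he]
      cases hl : G.kind l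
      case ctrlVoltage => exact absurd hl (hT.ne_voltage l.2).2
      case ctrlCurrent => exact Or.inl (hF l ⟨e, heT⟩ hl he)
      all_goals exact Or.inr (by simp [extend, deltaCurrent, hl, hφ])
    · refine residual_congr_link heT ?_ fun b => ?_
      · rw [extend_of_mem _ he]
        simp only [deltaVoltage, Finset.mem_singleton, hnc, hni, if_false, dif_neg,
          not_false_eq_true, dif_pos he]
      cases hb : G.kind b
      case ctrlCurrent => exact absurd hb (hT.ne_current b.2).2
      case ctrlVoltage => exact Or.inr (by simp [extend, deltaVoltage, hb, hv])
      all_goals exact Or.inr (by simp [extend, deltaVoltage, hb, hq]))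
  funext e
  by_cases he : G.kind e.1 = resistor
  · simpa [deltaDissCurrent, he] using congrFun h1 e
  · simpa [deltaDissVoltage, he] using congrFun h2 e

theorem ctrlVoltage_current_eq_zero (hφ : flux y = 0)
    (hw : dissVar y = 0) (hi : ∀ e : G.Branch controlled, G.kind e = ctrlCurrent →
      y (Sum.inr e) = 0) {e : G.Branch controlled} (he : G.kind e = ctrlVoltage) :
    y (Sum.inr e) = 0 := by
  have heT : e.1 ∈ T := hT.voltage_subset (mem_edges.2 (by rw [he]; decide))
  have := h.delta ⟨e.1, controlled_subset e.2⟩ (by simp [IsDifferential, he])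
  rw [residual_twig _ _ heT, Finset.sum_eq_zero, sub_zero] at this
  · simpa [deltaCurrent, he] using this
  · intro l _
    rw [mul_eq_zero]
    right
    cases hl : G.kind l
    case ctrlVoltage => exact absurd hl (hT.ne_voltage l.2).2
    all_goals simp [deltaCurrent, deltaDissCurrent, hl, hφ, hw, hi]

theorem ctrlCurrent_voltage_eq_zero (hq : charge y = 0)
    (hw : dissVar y = 0) (hv : ∀ e : G.Branch internal, G.kind e = ctrlVoltage →
      y (Sum.inl e) = 0) {e : G.Branch internal} (he : G.kind e = ctrlCurrent) :
    y (Sum.inl e) = 0 := by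
  have heT : e.1 ∉ T := fun heT => (hT.ne_current heT).2 he
  have := h.delta e (by simp [IsDifferential, he])
  rw [residual_link _ _ heT, Finset.sum_eq_zero, add_zero] at this
  · simpa [deltaVoltage, he] using this
  · intro b _
    rw [mul_eq_zero]
    right
    cases hb : G.kind b
    case ctrlCurrent => exact absurd hb (hT.ne_current b.2).2
    all_goals simp [deltaVoltage, deltaDissVoltage, hb, hq, hw, hv]

end IsLinearizedSolution

theorem gammaV_congr (D : G.Data) (t : ℝ) {x x' : G.Var → ℝ} (hq : charge x = charge x')
    (hφ : flux x = flux x') : D.gammaV t x = D.gammaV t x' := by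
  rw [gammaV, gammaV, hq, hφ]

theorem gammaI_congr (D : G.Data) (t : ℝ) {x x' : G.Var → ℝ} (hq : charge x = charge x')
    (hφ : flux x = flux x') (hw : dissVar x = dissVar x') : D.gammaI t x = D.gammaI t x' := by
  rw [gammaI, gammaI, hq, hφ, hw]

theorem eq_zero_of_hasDerivAt_add_smul_sub_const {κ : Type*} [Fintype κ] {x y : κ → ℝ} {i : κ}
    {c : ℝ} (h : HasDerivAt (fun s : ℝ => (x + s • y) i - c) 0 0) : y i = 0 :=
  ((hasDerivAt_pi.1 (hasDerivAt_add_smul x y) i).sub_const c).unique h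

/-- Injectivity of the linearized system. -/
theorem eq_zero_of_linearization_eq_zero {D : G.Data} (hT : G.IsNormalTree T)
    (hstore : D.StoragePassive) (hdiss : D.DissipatorsPassive) (hmix : D.MixedForm)
    (hVS : ∀ C, G.IsCycle C → C ⊆ G.edges (insert capacitor Kind.voltage) →
      Disjoint C (G.edges {ctrlVoltage}))
    (hCS : ∀ C, G.IsCutset C → C ⊆ G.edges (insert inductor Kind.current) →
      Disjoint C (G.edges {ctrlCurrent}))
    (hF : ∀ (l : {e : ε // e ∉ T}) (b : {e : ε // e ∈ T}),
      G.kind l = ctrlCurrent → G.kind b ∈ dissipator → G.ccMatrix T l b = 0)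
    (t : ℝ) {x y : G.Var → ℝ} (hx : dissVar x ∈ D.Ω)
    (hL : ∀ i ∉ algebraicRows G T, rateMap G T y i = 0)
    (hA : ∀ i ∈ algebraicRows G T, HasDerivAt (fun s : ℝ => D.system T t (x + s • y) 0 i) 0 0) :
    y = 0 := by
  have h : IsLinearizedSolution D T x y :=
    ⟨fun e he => hL (Sum.inl e) (by rwa [inl_mem_algebraicRows, not_not]), fun e he =>
      (hasDerivAt_residual (hasDerivAt_current hstore hmix t hx y)
        (hasDerivAt_voltage hstore hmix t hx y) e.1).unique
        (hA (Sum.inl e) (inl_mem_algebraicRows.2 he))⟩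
  have hq := h.charge_eq_zero hT hstore hVS
  have hφ := h.flux_eq_zero hT hstore hCS
  have hq' : ∀ s : ℝ, charge (x + s • y) = charge x := fun s => by
    rw [charge, part_add_smul, ← charge, ← charge, hq, smul_zero, add_zero]
  have hφ' : ∀ s : ℝ, flux (x + s • y) = flux x := fun s => by
    rw [flux, part_add_smul, ← flux, ← flux, hφ, smul_zero, add_zero]
  have hlaw : ∀ e : G.Branch controlled,
      HasDerivAt (fun s : ℝ => D.sourceLaw t (x + s • y) e) 0 0 :=
    fun e => hA (Sum.inr e) (inr_mem_algebraicRows e)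
  -- Along `x + s y` charges and fluxes are now constant, hence so is `γ_v`, and the source law
  -- differentiates to the component of `y` itself. The same works for `γ_I` once `w` is known to be
  -- constant too.
  have hv : ∀ e : G.Branch internal, G.kind e = ctrlVoltage → y (Sum.inl e) = 0 := by
    intro e he
    have hmem : G.kind e ∈ ({ctrlVoltage} : Finset Kind) := Finset.mem_singleton.2 he
    have := hlaw ⟨e.1, by rw [he]; decide⟩
    simp only [sourceLaw, dif_pos hmem, D.gammaV_congr t (hq' _) (hφ' _)] at this
    exact eq_zero_of_hasDerivAt_add_smul_sub_const this
  have hw := h.dissVar_eq_zero hT hdiss hmix hF hx hq hφ hv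
  have hw' : ∀ s : ℝ, dissVar (x + s • y) = dissVar x := fun s => by
    rw [dissVar, part_add_smul, ← dissVar, ← dissVar, hw, smul_zero, add_zero]
  have hi : ∀ e : G.Branch controlled, G.kind e = ctrlCurrent → y (Sum.inr e) = 0 := by
    intro e he
    have hmem : G.kind e ∉ ({ctrlVoltage} : Finset Kind) := by rw [he]; decide
    have := hlaw e
    simp only [sourceLaw, dif_neg hmem, D.gammaI_congr t (hq' _) (hφ' _) (hw' _)] at this
    exact eq_zero_of_hasDerivAt_add_smul_sub_const this
  funext i
  rcases i with ⟨e, he⟩ | ⟨e, he⟩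
  · have he' := he
    cases hk : G.kind e
    case capacitor => exact congrFun hq ⟨e, by simp [hk]⟩
    case inductor => exact congrFun hφ ⟨e, by simp [hk]⟩
    case resistor => exact congrFun hw ⟨e, by simp [hk]⟩
    case conductor => exact congrFun hw ⟨e, by simp [hk]⟩
    case ctrlVoltage => exact hv _ hk
    case ctrlCurrent => exact h.ctrlCurrent_voltage_eq_zero hT hq hw hv hk
    all_goals
      rw [hk] at he'
      exact absurd he' (by decide)
  · have he' := he
    cases hk : G.kind e
    case ctrlVoltage => exact h.ctrlVoltage_current_eq_zero hT hφ hw hi hk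
    case ctrlCurrent => exact hi _ hk
    all_goals
      rw [hk] at he'
      exact absurd he' (by decide)

/-! ### Element counts and the absence of algebraic rows. -/

theorem nLink_eq_zero_iff {K : Finset Kind} : G.nLink T K = 0 ↔ ∀ e, G.kind e ∈ K → e ∈ T := by
  simp only [nLink, Finset.card_eq_zero, Finset.sdiff_eq_empty_iff_subset, Finset.subset_iff,
    mem_edges]

theorem nTwig_eq_zero_iff {K : Finset Kind} : G.nTwig T K = 0 ↔ ∀ e, G.kind e ∈ K → e ∉ T := by
  simp only [nTwig, Finset.card_eq_zero, ← Finset.disjoint_iff_inter_eq_empty,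
    Finset.disjoint_left, mem_edges]

/-- In a normal tree every controlled voltage source is a twig and every controlled current source a
link, so the two counts cover all controlled sources. With all six counts zero, the only rows left
belong to capacitor twigs and inductor links. -/
theorem algebraicRows_eq_empty_iff (hT : G.IsNormalTree T) :
    algebraicRows G T = ∅ ↔
      G.nLink T {capacitor} = 0 ∧ G.nTwig T {inductor} = 0 ∧
        G.nTwig T dissipator = 0 ∧ G.nLink T dissipator = 0 ∧
        G.nTwig T {ctrlVoltage} = 0 ∧ G.nLink T {ctrlCurrent} = 0 := by
  simp only [nLink_eq_zero_iff, nTwig_eq_zero_iff, Set.eq_empty_iff_forall_notMem]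
  constructor
  · intro h
    have hd : ∀ e : G.Branch internal, IsDifferential T e := fun e =>
      not_not.1 fun hn => h (Sum.inl e) (inl_mem_algebraicRows.2 hn)
    have hd' : ∀ (e : ε) (he : G.kind e ∈ internal),
        (G.kind e = capacitor ∧ e ∈ T) ∨ (G.kind e = inductor ∧ e ∉ T) := fun e he => hd ⟨e, he⟩
    have hc : ∀ e, G.kind e ∉ controlled := fun e he => h _ (inr_mem_algebraicRows ⟨e, he⟩)
    have hdis : ∀ e, G.kind e ∉ dissipator := by
      intro e he
      rcases hd' e (by revert he; generalize G.kind e = k; cases k <;> decide) with h1 | h1 <;>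
        simp [h1.1] at he
    refine ⟨fun e he => ?_, fun e he => ?_, fun e he => absurd he (hdis e),
      fun e he => absurd he (hdis e), fun e he => absurd ?_ (hc e), fun e he => absurd ?_ (hc e)⟩
    · rw [Finset.mem_singleton] at he
      simpa [he] using hd' e (by rw [he]; decide)
    · rw [Finset.mem_singleton] at he
      simpa [he] using hd' e (by rw [he]; decide)
    · rw [Finset.mem_singleton] at he
      rw [he]; decide
    · rw [Finset.mem_singleton] at he
      rw [he]; decide
  · rintro ⟨h1, h2, h3, h4, h5, h6⟩
    have hd : ∀ e, G.kind e ∉ dissipator := fun e he => h3 e he (h4 e he)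
    have hv : ∀ e, G.kind e ≠ ctrlVoltage := fun e he =>
      h5 e (by simp [he]) (hT.voltage_subset (mem_edges.2 (by rw [he]; decide)))
    have hi : ∀ e, G.kind e ≠ ctrlCurrent := fun e he =>
      (hT.ne_current (h6 e (by simp [he]))).2 he
    rintro (⟨e, he⟩ | ⟨e, he⟩)
    · rw [inl_mem_algebraicRows, not_not]
      have hde := hd e
      have hve := hv e
      have hie := hi e
      have he' := he
      cases hk : G.kind e
      case capacitor => exact Or.inl ⟨hk, h1 e (by simp [hk])⟩
      case inductor => exact Or.inr ⟨hk, h2 e (by simp [hk])⟩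
      all_goals
        exfalso
        rw [hk] at hde hve hie he'
        revert hde hve hie he'
        decide
    · exfalso
      have hve := hv e
      have hie := hi e
      revert he hve hie
      generalize G.kind e = k
      cases k <;> decide

end Data

end Network

end Circuit

theorem theorem4p10 {𝒱 ε : Type*} [Fintype 𝒱] [DecidableEq 𝒱] [Fintype ε] [DecidableEq ε]
    -- a connected circuit graph, its constitutive data, and a tree
    (G : Circuit.Network 𝒱 ε) (D : G.Data) (T : Finset ε)
    (hG : G.IsSpanning Finset.univ)
    (hreg : D.Regular)
    -- no cycles of voltage sources, no cutsets of current sources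
    (hV : ∀ C, G.IsCycle C → ¬ C ⊆ G.edges Circuit.Kind.voltage)
    (hI : ∀ C, G.IsCutset C → ¬ C ⊆ G.edges Circuit.Kind.current)
    -- the tree is normal
    (hT : G.IsNormalTree T)
    -- passivity of capacitors, inductors and dissipators
    (hstore : D.StoragePassive) (hdiss : D.DissipatorsPassive)
    -- mixed form of the dissipators
    (hmix : D.MixedForm)
    -- no controlled voltage source is part of a cycle of capacitors and voltage sources
    (hVS : ∀ C, G.IsCycle C → C ⊆ G.edges (insert .capacitor Circuit.Kind.voltage) →
      Disjoint C (G.edges {.ctrlVoltage}))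
    -- no controlled current source is part of a cutset of inductors and current sources
    (hCS : ∀ C, G.IsCutset C → C ⊆ G.edges (insert .inductor Circuit.Kind.current) →
      Disjoint C (G.edges {.ctrlCurrent}))
    -- the block of the cycle-cutset matrix (controlled current links, dissipator twigs) vanishes
    (hF : ∀ (l : {e : ε // e ∉ T}) (b : {e : ε // e ∈ T}),
      G.kind l = .ctrlCurrent → G.kind b ∈ Circuit.Kind.dissipator → G.ccMatrix T l b = 0) :
    ((G.nLink T {.capacitor} = 0 ∧ G.nTwig T {.inductor} = 0 ∧
        G.nTwig T Circuit.Kind.dissipator = 0 ∧ G.nLink T Circuit.Kind.dissipator = 0 ∧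
        G.nTwig T {.ctrlVoltage} = 0 ∧ G.nLink T {.ctrlCurrent} = 0) →
      Dae.IsODE D.domain (D.system T)) ∧
    (¬ (G.nLink T {.capacitor} = 0 ∧ G.nTwig T {.inductor} = 0 ∧
        G.nTwig T Circuit.Kind.dissipator = 0 ∧ G.nLink T Circuit.Kind.dissipator = 0 ∧
        G.nTwig T {.ctrlVoltage} = 0 ∧ G.nLink T {.ctrlCurrent} = 0) →
      ∀ (t : ℝ) (x : G.Var → ℝ), (t, x) ∈ D.domain → (∃ xp, D.system T t x xp = 0) →
        Dae.HasIndexAt D.𝕋 D.domain (D.system T) t x 1) := by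
  have h : Dae.IsSemiExplicit D.𝕋 D.stateDomain (D.system T) (Circuit.Network.Data.rateMap G T)
      (fun p => D.system T p.1 p.2 0) (Circuit.Network.Data.algebraicRows G T) :=
    { uniqueDiffOn := Dae.uniqueDiffOn_of_nontrivial_ordConnected hreg.interval hreg.nontrivial
      isOpen := hmix.isOpen.preimage
        (continuous_pi fun _ => continuous_apply _)
      eq_affine := D.system_eq
      contDiffOn := Circuit.Network.Data.contDiffOn_system hreg hstore hmix
      algebraic := fun _ hi y => Circuit.Network.Data.rateMap_eq_zero hT hVS hCS hi y
      injective := fun p hp _ hL hA => Circuit.Network.Data.eq_zero_of_linearization_eq_zero hT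
        hstore hdiss hmix hVS hCS hF p.1 hp.2 hL hA }
  rw [← Circuit.Network.Data.algebraicRows_eq_empty_iff hT]
  -- `D.domain` agrees by definition with the product `D.𝕋 ×ˢ D.stateDomain` used in `h`.
  exact ⟨h.isODE, fun hne _ _ hp hc =>
    h.hasIndexAt_one (Set.nonempty_iff_ne_empty.2 hne) hp hc⟩
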